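/- Let $v$ be a positive integer and let $K_v$ be the complete graph with vertex set $\{0,1,\ldots,v-1\}$. The length of an edge $\{x,y\}$ of $K_v$ is $\ell(x,y)=\min(|y-x|,\,v-|y-x|)$. A multiset $L$ is called realizable in $K_v$ if there is a Hamiltonian path of $K_v$ whose multiset of edge lengths is $L$. Theorem. Let $v$ be a positive integer with $v\notin\{47,49,59\}$, and let $L$ be a multiset of size $v-1$ whose support (set of distinct elements) is exactly $\{1,6,18\}$. Suppose that $\{1,6,18\}\subseteq\{1,2,\ldots,\lfloor v/2\rfloor\}$ and that $\gcd(v,x)=1$ for every $x\in L$. Then $L$ is realizable in $K_v$. (That is, the Coprime Buratti–Horak–Rosa Conjecture holds for the support $\{1,6,18\}$ for every $v$ except possibly $v=47$, $49$ and $59$.) -/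

import Mathlib

/-- The length `min (|y - x|, v - |y - x|)` of an edge of `K_v` between the vertices `x` and `y`,
where the vertices are `0, 1, …, v - 1`. -/
def cyclicLength {v : ℕ} (x y : Fin v) : ℕ :=
  min (Nat.dist x y) (v - Nat.dist x y)

theorem cyclicLength_comm {v : ℕ} (x y : Fin v) : cyclicLength x y = cyclicLength y x := by
  simp only [cyclicLength, Nat.dist_comm]

/-- The length of an edge of `K_v`, as a function on unordered pairs of vertices. -/
def edgeLength {v : ℕ} : Sym2 (Fin v) → ℕ :=
  Sym2.lift ⟨cyclicLength, cyclicLength_comm⟩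

/-- A multiset `L` is realizable in `K_v` if it is the multiset of edge lengths of a Hamiltonian
path of the complete graph `K_v`. -/
def IsRealizable (v : ℕ) (L : Multiset ℕ) : Prop :=
  ∃ (x y : Fin v) (p : (⊤ : SimpleGraph (Fin v)).Walk x y),
    p.IsHamiltonian ∧ ((p.edges.map edgeLength : List ℕ) : Multiset ℕ) = L

/-- The hypotheses of the Coprime Buratti-Horak-Rosa Conjecture for a multiset `L` at `v`:
`L` has size `v - 1`, its support is contained in `{1, …, ⌊v/2⌋}`,
and every element of `L` is coprime to `v`. -/
structure StronglyAdmissible (v : ℕ) (L : Multiset ℕ) : Prop where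
  card_add_one : L.card + 1 = v
  support_subset : ∀ x ∈ L, 1 ≤ x ∧ x ≤ v / 2
  coprime : ∀ x ∈ L, Nat.gcd v x = 1

/-- The Coprime Buratti-Horak-Rosa Conjecture holds for the support `S` at `v`: every multiset
with support exactly `S` that satisfies the hypotheses of the conjecture is realizable. -/
def CoprimeBHRHolds (v : ℕ) (S : Finset ℕ) : Prop :=
  ∀ L : Multiset ℕ, L.toFinset = S → StronglyAdmissible v L → IsRealizable v L

/-!
A Hamiltonian path of `K_v` is regarded as a walk on the circle `ℤ/v` whose steps are `±1`, `±6`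
and `±18`; a step covers an arc of the circle. Cut the circle between two consecutive vertices. If
exactly `y` arcs cross the cut, then `y` new vertices can be put into it, each arc that crosses
the cut being led through one of them: an arc of length `ℓ` is replaced by an arc of length `ℓ`
and one of length `y`, and the new vertex is either `y` steps after the left endpoint or at the
old place of the right endpoint. If the new vertices reached in this way are all different, the
result is a Hamiltonian path on `v + y` vertices whose multiset of lengths has `y` more elements
`y` (`Spans.grow`, `map_snd_bind_growArc`). Here `y` is `1`, `6` or `18`.

The growth can be repeated, since the new path is again growable at the same cut. Moreover, growth
by `18` does not affect whether the path is growable by `1` or `6` elsewhere, and growth by `1`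
does not affect growth by `6`, even where an arc crosses several of the cuts (`slots_growArc`). So
a path with lengths `1 ^ a, 6 ^ b, 18 ^ c` that is growable by several of the three numbers yields
paths for all `1 ^ (a + i), 6 ^ (b + 6 * j), 18 ^ (c + 18 * k)`, where `i`, `j`, `k` vanish unless
there is growth by the respective number (`Attains.add`). It is not needed that `36 < v` for the
path from which the growth starts: the arcs of length `18` may go the long way round.

It remains to give finitely many paths from which all multisets in question arise. They are listed
in `Certificate.certificates`; that they are Hamiltonian paths with the stated properties
(`Certificate.check_certificates`) and that they suffice (`Certificate.isCovered_of_le`) is a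
computation. For `a ≥ 18` paths growable by `1` are used, and the residues of `b` modulo `6` and
of `c` modulo `18` are arbitrary. For `a < 18` only multisets with `v` coprime to `6` are needed;
this condition is respected by the growth by `6` and `18`.
-/

/-! ### Walks along arcs of a circle, and their growth at a cut -/

/-- The number of steps forward from the vertex `u` of the circle `ℤ/v` to the cut in front of the
vertex `n`; it lies in `{1, …, v}`. -/
def ahead (v n u : ℕ) : ℕ := if u < n then n - u else n + v - u

/-- `IsArc v u ℓ w`: in the circle `ℤ/v`, with vertices `0, …, v - 1`, going `ℓ` steps forward from
`u` leads to `w`, where `ℓ` is one of the lengths `1`, `6`, `18`. -/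
structure IsArc (v u ℓ w : ℕ) : Prop where
  length : ℓ = 1 ∨ ℓ = 6 ∨ ℓ = 18
  left_lt : u < v
  right_lt : w < v
  step : w = u + ℓ ∨ w + v = u + ℓ

/-- `ArcWalk v u l A`: there is a walk on the circle `ℤ/v` that starts at `u`, visits the vertices
`l` in this order, and moves along the arcs `A`. The arc `(x, ℓ)` joins `x` to `x + ℓ`; the walk may
run through it in either direction. -/
inductive ArcWalk (v : ℕ) : ℕ → List ℕ → Multiset (ℕ × ℕ) → Prop
  | nil {u : ℕ} : u < v → ArcWalk v u [u] 0
  | forward {u w ℓ : ℕ} {l : List ℕ} {A : Multiset (ℕ × ℕ)} :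
      IsArc v u ℓ w → ArcWalk v w l A → ArcWalk v u (u :: l) ((u, ℓ) ::ₘ A)
  | backward {u w ℓ : ℕ} {l : List ℕ} {A : Multiset (ℕ × ℕ)} :
      IsArc v w ℓ u → ArcWalk v w l A → ArcWalk v u (u :: l) ((w, ℓ) ::ₘ A)

/-- The slot, among `y` new vertices put into the cut `n`, that is used by the arc `e`; there is
none if `e` does not cross the cut. If the left endpoint of `e` is one of the last `y` vertices
before the cut, the new vertex lies `y` steps after it; otherwise the new vertex takes the old place
of the right endpoint. In the second case the slot may be `y` or larger, and then it is not a
possible slot. -/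
def arcSlot (v n y : ℕ) (e : ℕ × ℕ) : Multiset ℕ :=
  if e.2 < ahead v n e.1 then 0
  else {if ahead v n e.1 ≤ y then y - ahead v n e.1 else e.2 - ahead v n e.1}

/-- The slots at the cut `n` used by the arcs `A`. -/
def slots (v n y : ℕ) (A : Multiset (ℕ × ℕ)) : Multiset ℕ := A.bind (arcSlot v n y)

/-- The arcs `A` are growable by `y` at the cut `n`: exactly `y` of them cross the cut, and they use
every slot once. -/
structure Growable (v n y : ℕ) (A : Multiset (ℕ × ℕ)) : Prop where
  lt : n < v
  slots_eq : slots v n y A = Multiset.range y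

/-- The new name of the vertex or cut `p` after `y` vertices have been put into the cut `n`. -/
def shift (n y p : ℕ) : ℕ := if p < n then p else p + y

/-- What becomes of an arc when `y` vertices are put into the cut `n`: an arc crossing the cut is
replaced by an arc of the same length and an arc of length `y`, joined at the new vertex in its
slot. -/
def growArc (v n y : ℕ) (e : ℕ × ℕ) : Multiset (ℕ × ℕ) :=
  if e.2 < ahead v n e.1 then {(shift n y e.1, e.2)}
  else if ahead v n e.1 ≤ y then {(shift n y e.1, y), (n + (y - ahead v n e.1), e.2)}
  else {(shift n y e.1, e.2), (n + (e.2 - ahead v n e.1), y)}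

/-- An arc that does not cross the cut stays an arc; one that does is replaced by two arcs that meet
in the new vertex. -/
theorem IsArc.grow {v n y u ℓ w : ℕ} (hv : 18 < v) (hn : n < v) (hy : y = 1 ∨ y = 6 ∨ y = 18)
    (h : IsArc v u ℓ w) (hd : ∀ d ∈ arcSlot v n y (u, ℓ), d < y) :
    (growArc v n y (u, ℓ) = {(shift n y u, ℓ)} ∧ arcSlot v n y (u, ℓ) = 0 ∧
      IsArc (v + y) (shift n y u) ℓ (shift n y w)) ∨
    ∃ d ℓ₁ ℓ₂, growArc v n y (u, ℓ) = {(shift n y u, ℓ₁), (n + d, ℓ₂)} ∧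
      arcSlot v n y (u, ℓ) = {d} ∧ IsArc (v + y) (shift n y u) ℓ₁ (n + d) ∧
      IsArc (v + y) (n + d) ℓ₂ (shift n y w) := by
  obtain ⟨hl, hu, hw, hs⟩ := h
  unfold growArc arcSlot at *
  have hu' : shift n y u < v + y := by unfold shift; split_ifs <;> omega
  have hw' : shift n y w < v + y := by unfold shift; split_ifs <;> omega
  by_cases h1 : ℓ < ahead v n u
  · refine .inl ⟨by simp [h1], by simp [h1], hl, hu', hw', ?_⟩
    unfold ahead at h1; unfold shift; split_ifs at * <;> omega
  by_cases h2 : ahead v n u ≤ y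
  · simp only [h1, h2, if_true, if_false, Multiset.mem_singleton, forall_eq] at hd
    refine .inr ⟨y - ahead v n u, y, ℓ, by simp [h1, h2], by simp [h1, h2],
      ⟨hy, hu', by omega, ?_⟩, hl, by omega, hw', ?_⟩
    all_goals unfold ahead at *; unfold shift; split_ifs at * <;> omega
  · simp only [h1, h2, if_false, Multiset.mem_singleton, forall_eq] at hd
    refine .inr ⟨ℓ - ahead v n u, ℓ, y, by simp [h1, h2], by simp [h1, h2],
      ⟨hl, hu', by omega, ?_⟩, hy, by omega, hw', ?_⟩
    all_goals unfold ahead at *; unfold shift; split_ifs at * <;> omega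

/-- Putting `y` vertices into a cut turns a walk into a walk, provided that the arcs crossing the
cut use slots below `y`; the new walk visits in addition the new vertices in these slots. -/
theorem ArcWalk.grow {v n y : ℕ} (hv : 18 < v) (hn : n < v) (hy : y = 1 ∨ y = 6 ∨ y = 18)
    {u : ℕ} {l : List ℕ} {A : Multiset (ℕ × ℕ)} (h : ArcWalk v u l A)
    (hA : ∀ d ∈ slots v n y A, d < y) :
    ∃ l' : List ℕ, ArcWalk (v + y) (shift n y u) l' (A.bind (growArc v n y)) ∧
      (l' : Multiset ℕ) = (l : Multiset ℕ).map (shift n y) + (slots v n y A).map (n + ·) := by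
  induction h with
  | @nil u hu =>
    refine ⟨[shift n y u], ?_, by simp [slots]⟩
    rw [Multiset.zero_bind]
    exact .nil (by unfold shift; split_ifs <;> omega)
  | @forward u w ℓ l A h _ ih =>
    simp only [slots, Multiset.cons_bind, Multiset.mem_add] at hA ih ⊢
    obtain ⟨l', h', e'⟩ := ih fun d hd => hA d (.inr hd)
    rcases h.grow hv hn hy fun d hd => hA d (.inl hd) with
      ⟨hg, hs, h₁⟩ | ⟨d, ℓ₁, ℓ₂, hg, hs, h₁, h₂⟩ <;> rw [hg, hs]
    · exact ⟨_, .forward h₁ h', by simp [← Multiset.cons_coe, e']⟩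
    · rw [Multiset.insert_eq_cons, Multiset.cons_add, Multiset.singleton_add]
      exact ⟨_, .forward h₁ (.forward h₂ h'), by
        simp [← Multiset.cons_coe, e', Multiset.cons_swap (n + d)]⟩
  | @backward w u ℓ l A h _ ih =>
    simp only [slots, Multiset.cons_bind, Multiset.mem_add] at hA ih ⊢
    obtain ⟨l', h', e'⟩ := ih fun d hd => hA d (.inr hd)
    rcases h.grow hv hn hy fun d hd => hA d (.inl hd) with
      ⟨hg, hs, h₁⟩ | ⟨d, ℓ₁, ℓ₂, hg, hs, h₁, h₂⟩ <;> rw [hg, hs]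
    · exact ⟨_, .backward h₁ h', by simp [← Multiset.cons_coe, e']⟩
    · rw [Multiset.pair_comm, Multiset.insert_eq_cons, Multiset.cons_add, Multiset.singleton_add]
      exact ⟨_, .backward h₂ (.backward h₁ h'), by
        simp [← Multiset.cons_coe, e', Multiset.cons_swap (n + d)]⟩

/-- The distance from an old vertex to a cut changes if the cut `n` lies in between. -/
theorem ahead_shift {v n y m u : ℕ} (hn : n < v) (hm : m < v) (hu : u < v) :
    ahead (v + y) (shift n y m) (shift n y u) =
      if ahead v n u ≤ ahead v m u then ahead v m u + y else ahead v m u := by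
  unfold ahead shift; split_ifs <;> omega

/-- The distance from the new vertex in slot `d` of the cut `n` to the cut `m`, expressed by the
distances from some vertex `u` to the two cuts before the growth. -/
theorem ahead_add {v n y m u d : ℕ} (hn : n < v) (hm : m < v) (hu : u < v) (hd : d < y) :
    ahead (v + y) (shift n y m) (n + d) =
      if ahead v n u ≤ ahead v m u then ahead v m u - ahead v n u + (y - d)
      else ahead v m u + v - ahead v n u + (y - d) := by
  unfold ahead shift; split_ifs <;> omega

/-- Growth by `18` does not disturb the slots at any cut, growth by `1` does not disturb the slots
for `6` at another cut, and growth at a cut does not disturb the slots at this cut itself. The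
reason is that of the two pieces of an arc exactly one crosses the cut `m` if the arc does, and
that this piece has kept its distance to `m` on the side that determines the slot. -/
theorem slots_growArc {v n y m z : ℕ} (hv : 18 < v) (hn : n < v) (hm : m < v)
    (hyz : y = 18 ∧ (z = 18 ∨ z = 1 ∨ z = 6) ∨ y = 1 ∧ z = 6 ∧ m ≠ n ∨
      (y = 1 ∨ y = 6) ∧ z = y ∧ m = n)
    {u ℓ w : ℕ} (h : IsArc v u ℓ w) (hd : ∀ d ∈ arcSlot v n y (u, ℓ), d < y)
    (hd' : ∀ d ∈ arcSlot v m z (u, ℓ), d < z) :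
    (growArc v n y (u, ℓ)).bind (arcSlot (v + y) (shift n y m) z) = arcSlot v m z (u, ℓ) := by
  have hl := h.length
  have hu := h.left_lt
  have hp : 1 ≤ ahead v n u ∧ ahead v n u ≤ v := by unfold ahead; split_ifs <;> omega
  have hq : 1 ≤ ahead v m u ∧ ahead v m u ≤ v := by unfold ahead; split_ifs <;> omega
  -- From here on, only the distances `p` and `q` from `u` to the cuts `n` and `m` matter.
  have hmn : m = n ↔ ahead v m u = ahead v n u := by unfold ahead; split_ifs <;> omega
  have hu' := ahead_shift (y := y) hn hm hu
  have hd₁ := fun d hd => ahead_add (y := y) (d := d) hn hm hu hd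
  unfold growArc
  unfold arcSlot at *
  generalize ahead v n u = p at *
  generalize ahead v m u = q at *
  by_cases h1 : ℓ < p
  · simp only [h1, if_true, Multiset.singleton_bind, hu']
    split_ifs <;> first | omega | rfl
  by_cases h2 : p ≤ y
  · simp only [h1, h2, if_true, if_false, Multiset.mem_singleton, forall_eq] at hd
    simp only [h1, h2, if_true, if_false, Multiset.insert_eq_cons, Multiset.cons_bind,
      Multiset.singleton_bind, hu', hd₁ _ hd]
    split_ifs at * <;> first | omega | rfl |
      (simp only [zero_add, add_zero, Multiset.singleton_inj, Multiset.mem_singleton,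
        forall_eq] at *; omega)
  · simp only [h1, h2, if_false, Multiset.mem_singleton, forall_eq] at hd
    simp only [h1, h2, if_false, Multiset.insert_eq_cons, Multiset.cons_bind,
      Multiset.singleton_bind, hu', hd₁ _ hd]
    split_ifs at * <;> first | omega | rfl |
      (simp only [zero_add, Multiset.singleton_inj, Multiset.mem_singleton, forall_eq] at *; omega)

theorem map_snd_growArc (v n y : ℕ) (e : ℕ × ℕ) :
    (growArc v n y e).map Prod.snd = e.2 ::ₘ (arcSlot v n y e).map fun _ => y := by
  unfold growArc arcSlot
  split_ifs <;> simp [← Multiset.cons_zero, Multiset.cons_swap y]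

theorem map_snd_bind_growArc (v n y : ℕ) (A : Multiset (ℕ × ℕ)) :
    (A.bind (growArc v n y)).map Prod.snd =
      A.map Prod.snd + Multiset.replicate (slots v n y A).card y := by
  rw [← Multiset.map_const']
  unfold slots
  rw [Multiset.map_bind, Multiset.map_bind, ← Multiset.bind_singleton, ← Multiset.bind_add]
  simp only [map_snd_growArc, Multiset.singleton_add]

theorem ArcWalk.isArc {v u : ℕ} {l : List ℕ} {A : Multiset (ℕ × ℕ)} (h : ArcWalk v u l A) :
    ∀ e ∈ A, ∃ w, IsArc v e.1 e.2 w := by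
  induction h with
  | nil => simp
  | forward h _ ih =>
    intro e he
    rcases Multiset.mem_cons.1 he with rfl | he
    exacts [⟨_, h⟩, ih e he]
  | backward h _ ih =>
    intro e he
    rcases Multiset.mem_cons.1 he with rfl | he
    exacts [⟨_, h⟩, ih e he]

/-- The circle `ℤ/v` has a Hamiltonian path along the arcs `A`. -/
def Spans (v : ℕ) (A : Multiset (ℕ × ℕ)) : Prop :=
  ∃ u l, ArcWalk v u l A ∧ (l : Multiset ℕ) = Multiset.range v

/-- The vertices after the growth are the renamed old ones and the new ones. -/
theorem range_add_eq_map_shift {v n : ℕ} (y : ℕ) (hn : n < v) :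
    Multiset.range (v + y) =
      (Multiset.range v).map (shift n y) + (Multiset.range y).map (n + ·) := by
  have h₁ : Function.Injective (shift n y) := fun a b h => by
    unfold shift at h; split_ifs at h <;> omega
  refine (Multiset.Nodup.ext (Multiset.nodup_range _) ?_).2 fun a => ?_
  · refine (Multiset.Nodup.add_iff ((Multiset.nodup_range _).map h₁)
      ((Multiset.nodup_range _).map (add_right_injective n))).2 ?_
    rw [Multiset.disjoint_left]
    simp only [Multiset.mem_map, Multiset.mem_range, shift]
    rintro _ ⟨b, -, rfl⟩ ⟨c, hc, h⟩
    split_ifs at h <;> omega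
  · simp only [Multiset.mem_add, Multiset.mem_map, Multiset.mem_range, shift]
    constructor
    · intro ha
      by_cases h : a < n
      · exact .inl ⟨a, by omega, if_pos h⟩
      by_cases h' : a < n + y
      · exact .inr ⟨a - n, by omega, by omega⟩
      · exact .inl ⟨a - y, by omega, by split_ifs <;> omega⟩
    · rintro (⟨b, hb, rfl⟩ | ⟨b, hb, rfl⟩)
      · split_ifs <;> omega
      · omega

theorem Spans.grow {v n y : ℕ} {A : Multiset (ℕ × ℕ)} (hv : 18 < v)
    (hy : y = 1 ∨ y = 6 ∨ y = 18) (h : Spans v A) (hA : Growable v n y A) :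
    Spans (v + y) (A.bind (growArc v n y)) := by
  obtain ⟨u, l, hl, e⟩ := h
  obtain ⟨l', hl', e'⟩ := hl.grow hv hA.lt hy fun d hd => by simpa [hA.slots_eq] using hd
  exact ⟨_, l', hl', by rw [e', e, hA.slots_eq, ← range_add_eq_map_shift y hA.lt]⟩

/-- The number of arcs crossing a cut does not depend on the number of vertices to be put in. -/
theorem card_slots (v n y z : ℕ) (A : Multiset (ℕ × ℕ)) :
    (slots v n y A).card = (slots v n z A).card := by
  simp only [slots, Multiset.card_bind, Function.comp_def, arcSlot, apply_ite Multiset.card,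
    Multiset.card_singleton]

/-- Growth at a cut preserves growability at the same cut and, in the order `18`, `1`, `6`, at other
cuts. -/
theorem Growable.grow {v n y m z : ℕ} {A : Multiset (ℕ × ℕ)} (hv : 18 < v)
    (hyz : y = 18 ∧ (z = 18 ∨ z = 1 ∨ z = 6) ∨ y = 1 ∧ z = 6 ∨ (y = 1 ∨ y = 6) ∧ z = y ∧ m = n)
    (hs : Spans v A) (h : Growable v n y A) (h' : Growable v m z A) :
    Growable (v + y) (shift n y m) z (A.bind (growArc v n y)) := by
  refine ⟨by have := h'.lt; unfold shift; split_ifs <;> omega, ?_⟩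
  replace hyz : y = 18 ∧ (z = 18 ∨ z = 1 ∨ z = 6) ∨ y = 1 ∧ z = 6 ∧ m ≠ n ∨
      (y = 1 ∨ y = 6) ∧ z = y ∧ m = n := by
    have := card_slots v n y z A
    -- The same cut cannot be growable by two numbers.
    rcases eq_or_ne m n with rfl | hmn
    · rw [h.slots_eq, h'.slots_eq, Multiset.card_range, Multiset.card_range] at this
      omega
    · tauto
  rw [← h'.slots_eq]
  unfold slots
  rw [Multiset.bind_assoc]
  refine Multiset.bind_congr fun e he => ?_
  obtain ⟨u, l, hl, -⟩ := hs
  obtain ⟨w, hw⟩ := hl.isArc e he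
  refine slots_growArc hv h.lt h'.lt hyz hw (fun d hd => ?_) fun d hd => ?_
  · rw [← Multiset.mem_range, ← h.slots_eq]
    exact Multiset.mem_bind.2 ⟨e, he, hd⟩
  · rw [← Multiset.mem_range, ← h'.slots_eq]
    exact Multiset.mem_bind.2 ⟨e, he, hd⟩

/-! ### Multisets of lengths attained by growable paths -/

/-- The multiset with `a` elements `1`, `b` elements `6` and `c` elements `18`. -/
def lengths (a b c : ℕ) : Multiset ℕ :=
  Multiset.replicate a 1 + Multiset.replicate b 6 + Multiset.replicate c 18

/-- There is a Hamiltonian path with lengths `1 ^ a, 6 ^ b, 18 ^ c` that is growable by `1`, by `6`,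
by `18` whenever the respective flag is set. For fewer than `37` vertices the arcs of length `18`
may go the long way round the circle. -/
def Attains (a b c : ℕ) (g₁ g₆ g₁₈ : Bool) : Prop :=
  ∃ A : Multiset (ℕ × ℕ), Spans (a + b + c + 1) A ∧ A.map Prod.snd = lengths a b c ∧
    (g₁ → ∃ n, Growable (a + b + c + 1) n 1 A) ∧
    (g₆ → ∃ n, Growable (a + b + c + 1) n 6 A) ∧
    (g₁₈ → ∃ n, Growable (a + b + c + 1) n 18 A)

theorem Growable.map_snd_bind_growArc {v n y : ℕ} {A : Multiset (ℕ × ℕ)} (h : Growable v n y A) :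
    (A.bind (growArc v n y)).map Prod.snd = A.map Prod.snd + Multiset.replicate y y := by
  rw [_root_.map_snd_bind_growArc, h.slots_eq, Multiset.card_range]

theorem Attains.grow_eighteen {a b c : ℕ} {g₁ g₆ : Bool} (hv : 18 ≤ a + b + c)
    (h : Attains a b c g₁ g₆ true) : Attains a b (c + 18) g₁ g₆ true := by
  obtain ⟨A, hA, hL, h₁, h₆, h₁₈⟩ := h
  obtain ⟨n, hn⟩ := h₁₈ rfl
  have e : a + b + (c + 18) + 1 = a + b + c + 1 + 18 := by omega
  refine ⟨A.bind (growArc (a + b + c + 1) n 18), ?_, ?_, fun h => ?_, fun h => ?_, fun _ => ?_⟩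
  · rw [e]; exact hA.grow (by omega) (by simp) hn
  · rw [hn.map_snd_bind_growArc, hL, lengths, lengths, Multiset.replicate_add c, add_assoc]
  · obtain ⟨m, hm⟩ := h₁ h
    rw [e]; exact ⟨_, hn.grow (by omega) (by simp) hA hm⟩
  · obtain ⟨m, hm⟩ := h₆ h
    rw [e]; exact ⟨_, hn.grow (by omega) (by simp) hA hm⟩
  · rw [e]; exact ⟨_, hn.grow (by omega) (by simp) hA hn⟩

theorem Attains.grow_one {a b c : ℕ} {g₆ g₁₈ : Bool} (hv : 18 ≤ a + b + c)
    (h : Attains a b c true g₆ g₁₈) : Attains (a + 1) b c true g₆ false := by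
  obtain ⟨A, hA, hL, h₁, h₆, -⟩ := h
  obtain ⟨n, hn⟩ := h₁ rfl
  have e : a + 1 + b + c + 1 = a + b + c + 1 + 1 := by omega
  refine ⟨A.bind (growArc (a + b + c + 1) n 1), ?_, ?_, fun _ => ?_, fun h => ?_, nofun⟩
  · rw [e]; exact hA.grow (by omega) (by simp) hn
  · rw [hn.map_snd_bind_growArc, hL, lengths, lengths, Multiset.replicate_add a]; abel
  · rw [e]; exact ⟨_, hn.grow (by omega) (by simp) hA hn⟩
  · obtain ⟨m, hm⟩ := h₆ h
    rw [e]; exact ⟨_, hn.grow (by omega) (by simp) hA hm⟩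

theorem Attains.grow_six {a b c : ℕ} {g₁ g₁₈ : Bool} (hv : 18 ≤ a + b + c)
    (h : Attains a b c g₁ true g₁₈) : Attains a (b + 6) c false true false := by
  obtain ⟨A, hA, hL, -, h₆, -⟩ := h
  obtain ⟨n, hn⟩ := h₆ rfl
  have e : a + (b + 6) + c + 1 = a + b + c + 1 + 6 := by omega
  refine ⟨A.bind (growArc (a + b + c + 1) n 6), ?_, ?_, nofun, fun _ => ?_, nofun⟩
  · rw [e]; exact hA.grow (by omega) (by simp) hn
  · rw [hn.map_snd_bind_growArc, hL, lengths, lengths, Multiset.replicate_add b]; abel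
  · rw [e]; exact ⟨_, hn.grow (by omega) (by simp) hA hn⟩

theorem Attains.mono {a b c : ℕ} {g₁ g₆ g₁₈ g₁' g₆' g₁₈' : Bool} (h : Attains a b c g₁ g₆ g₁₈)
    (h₁ : g₁' → g₁) (h₆ : g₆' → g₆) (h₁₈ : g₁₈' → g₁₈) : Attains a b c g₁' g₆' g₁₈' := by
  obtain ⟨A, hA, hL, i₁, i₆, i₁₈⟩ := h
  exact ⟨A, hA, hL, fun h => i₁ (h₁ h), fun h => i₆ (h₆ h), fun h => i₁₈ (h₁₈ h)⟩

/-- Growth in all available directions. The order matters: the growth by `18` keeps the path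
growable by `1` and `6`, and the growth by `1` keeps it growable by `6`. -/
theorem Attains.add {a b c : ℕ} {g₁ g₆ g₁₈ : Bool} (hv : 18 ≤ a + b + c)
    (h : Attains a b c g₁ g₆ g₁₈) {i j k : ℕ} (h₁ : g₁ ∨ i = 0) (h₆ : g₆ ∨ j = 0)
    (h₁₈ : g₁₈ ∨ k = 0) : Attains (a + i) (b + 6 * j) (c + 18 * k) false false false := by
  have s₁₈ : Attains a b (c + 18 * k) g₁ g₆ false := by
    rcases h₁₈ with h₁₈ | rfl
    · have : Attains a b (c + 18 * k) g₁ g₆ true := by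
        induction k with
        | zero => exact h.mono id id (by simp [h₁₈])
        | succ k ih => exact Attains.grow_eighteen (c := c + 18 * k) (by omega) ih
      exact this.mono id id nofun
    · exact h.mono id id nofun
  have s₁ : Attains (a + i) b (c + 18 * k) false g₆ false := by
    rcases h₁ with h₁ | rfl
    · have : Attains (a + i) b (c + 18 * k) true g₆ false := by
        induction i with
        | zero => exact s₁₈.mono (by simp [h₁]) id id
        | succ i ih => exact Attains.grow_one (a := a + i) (by omega) ih
      exact this.mono nofun id id
    · exact s₁₈.mono nofun id id
  rcases h₆ with h₆ | rfl
  · have : Attains (a + i) (b + 6 * j) (c + 18 * k) false true false := by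
      induction j with
      | zero => exact s₁.mono id (by simp [h₆]) id
      | succ j ih => exact Attains.grow_six (b := b + 6 * j) (by omega) ih
    exact this.mono id nofun id
  · exact s₁.mono id nofun id

/-- From `37` vertices on, an arc of length at most `18` is a shortest way between its endpoints. -/
theorem IsArc.cyclicLength_eq {v u ℓ w : ℕ} (hv : 36 < v) (h : IsArc v u ℓ w) :
    cyclicLength (⟨u, h.left_lt⟩ : Fin v) ⟨w, h.right_lt⟩ = ℓ := by
  obtain ⟨hl, hu, hw, hs⟩ := h
  simp only [cyclicLength, Nat.dist]
  omega

theorem IsArc.ne {v u ℓ w : ℕ} (hv : 36 < v) (h : IsArc v u ℓ w) : u ≠ w := by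
  obtain ⟨hl, hu, hw, hs⟩ := h
  omega

theorem ArcWalk.lt {v u : ℕ} {l : List ℕ} {A : Multiset (ℕ × ℕ)} (h : ArcWalk v u l A) : u < v := by
  cases h with
  | nil h => exact h
  | forward h _ => exact h.left_lt
  | backward h _ => exact h.right_lt

theorem ArcWalk.exists_walk {v u : ℕ} {l : List ℕ} {A : Multiset (ℕ × ℕ)} (hv : 36 < v)
    (h : ArcWalk v u l A) : ∃ (y : Fin v) (p : (⊤ : SimpleGraph (Fin v)).Walk ⟨u, h.lt⟩ y),
      p.support.map Fin.val = l ∧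
        ((p.edges.map edgeLength : List ℕ) : Multiset ℕ) = A.map Prod.snd := by
  induction h with
  | nil hu => exact ⟨_, .nil, by simp, by simp⟩
  | forward h _ ih =>
    obtain ⟨y, p, hp, e⟩ := ih
    refine ⟨y, .cons (v := ⟨_, h.right_lt⟩) ?_ p, ?_, ?_⟩
    · exact fun h' => h.ne hv (congrArg Fin.val h')
    · rw [SimpleGraph.Walk.support_cons, List.map_cons, hp]
    · have : edgeLength s(⟨_, h.left_lt⟩, ⟨_, h.right_lt⟩) = _ := h.cyclicLength_eq hv
      simp [← Multiset.cons_coe, e, this]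
  | backward h _ ih =>
    obtain ⟨y, p, hp, e⟩ := ih
    refine ⟨y, .cons (v := ⟨_, h.left_lt⟩) ?_ p, ?_, ?_⟩
    · exact fun h' => h.ne hv (congrArg Fin.val h').symm
    · rw [SimpleGraph.Walk.support_cons, List.map_cons, hp]
    · have : edgeLength s(⟨_, h.right_lt⟩, ⟨_, h.left_lt⟩) = _ :=
        (cyclicLength_comm _ _).trans (h.cyclicLength_eq hv)
      simp [← Multiset.cons_coe, e, this]

theorem Attains.isRealizable {a b c : ℕ} {g₁ g₆ g₁₈ : Bool} (hv : 36 ≤ a + b + c)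
    (h : Attains a b c g₁ g₆ g₁₈) : IsRealizable (a + b + c + 1) (lengths a b c) := by
  obtain ⟨A, ⟨u, l, hl, e⟩, hL, -⟩ := h
  obtain ⟨y, p, hp, hpe⟩ := hl.exists_walk (by omega)
  refine ⟨_, y, p, fun x => ?_, hpe.trans hL⟩
  have h₁ : l.Nodup := by rw [← Multiset.coe_nodup, e]; exact Multiset.nodup_range _
  rw [← hp] at h₁
  refine List.count_eq_one_of_mem h₁.of_map ?_
  have h₂ : (x : ℕ) ∈ (l : Multiset ℕ) := by rw [e]; exact Multiset.mem_range.2 x.isLt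
  rw [← hp, Multiset.mem_coe, List.mem_map] at h₂
  obtain ⟨z, hz, hzx⟩ := h₂
  exact Fin.ext hzx ▸ hz

/-! ### Encoded paths and their verification -/

/-- The data of a Hamiltonian path of the circle `ℤ/v`, where `v = a + b + c + 1`, that starts at
`0` and has lengths `1 ^ a, 6 ^ b, 18 ^ c`. The base-`6` digits `0, …, 5` of `steps`, from the
lowest one on, stand for the steps `+1, -1, +6, -6, +18, -18`. The path is growable by `1`, `6`,
`18` at the cuts `n₁`, `n₆`, `n₁₈`, except that a value which is not below `v` (such as `99` in the
list below) claims nothing. -/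
structure Certificate where
  a : ℕ
  b : ℕ
  c : ℕ
  n₁ : ℕ
  n₆ : ℕ
  n₁₈ : ℕ
  steps : ℕ

namespace Certificate

/-- The length of the step with code `d`. -/
def stepLength (d : ℕ) : ℕ := bif Nat.ble d 1 then 1 else bif Nat.ble d 3 then 6 else 18

/-- The vertex reached from the vertex `u` of `ℤ/v` by the step with code `d`. -/
def next (v u d : ℕ) : ℕ :=
  bif Nat.beq (d % 2) 0 then
    bif Nat.ble v (u + stepLength d) then u + stepLength d - v else u + stepLength d
  else bif Nat.ble (stepLength d) u then u - stepLength d else u + v - stepLength d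

/-- The application `f x`, arranged so that the kernel evaluates `x` before it unfolds `f`. -/
def force {α : Type} (x : ℕ) (f : ℕ → α) : α :=
  match x with
  | 0 => f 0
  | x + 1 => f (x + 1)

theorem force_eq {α : Type} (x : ℕ) (f : ℕ → α) : force x f = f x := by cases x <;> rfl

/-- The vertices of the walk of `k` steps from `u` that is encoded by `s`. -/
def vertices (v : ℕ) : ℕ → ℕ → ℕ → List ℕ
  | 0, u, _ => [u]
  | k + 1, u, s =>
    u :: force (next v u (s % 6)) fun w => force (s / 6) fun s' => vertices v k w s'

/-- The arcs of the walk of `k` steps from `u` that is encoded by `s`. -/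
def arcs (v : ℕ) : ℕ → ℕ → ℕ → List (ℕ × ℕ)
  | 0, _, _ => []
  | k + 1, u, s =>
    force (s % 6) fun d => force (next v u d) fun w => force (bif Nat.beq (d % 2) 0 then u else w)
      fun x => force (stepLength d) fun ℓ => (x, ℓ) :: force (s / 6) fun s' => arcs v k w s'

/-- A number whose binary digits tell the elements of a list. -/
def mask : List ℕ → ℕ
  | [] => 0
  | x :: l => 2 ^ x ||| mask l

/-- A test whether a list is a permutation of `0, …, k - 1`. -/
def isRange (l : List ℕ) (k : ℕ) : Bool := Nat.beq l.length k && Nat.beq (mask l) (2 ^ k - 1)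

/-- The list version of `slots`. -/
def slotList (v n y : ℕ) : List (ℕ × ℕ) → List ℕ
  | [] => []
  | e :: l =>
    let δ := bif Nat.ble n e.1 then n + v - e.1 else n - e.1
    bif Nat.ble δ e.2 then (bif Nat.ble δ y then y - δ else e.2 - δ) :: slotList v n y l
    else slotList v n y l

/-- A test for growability by `y` at the cut `n`; nothing is tested if `n` is no cut. -/
def isGrowable (v n y : ℕ) (l : List (ℕ × ℕ)) : Bool :=
  Nat.ble v n || isRange (slotList v n y l) y

/-- The number of arcs of length `ℓ`. -/
def countLength (ℓ : ℕ) : List (ℕ × ℕ) → ℕ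
  | [] => 0
  | e :: l => bif Nat.beq e.2 ℓ then countLength ℓ l + 1 else countLength ℓ l

/-- The test that a certificate is what it claims to be. The number of arcs of length `18` need not
be tested, since it is determined by the others. -/
def check (t : Certificate) : Bool :=
  let v := t.a + t.b + t.c + 1
  let l := arcs v (t.a + t.b + t.c) 0 t.steps
  Nat.ble 19 v && isRange (vertices v (t.a + t.b + t.c) 0 t.steps) v &&
    Nat.beq (countLength 1 l) t.a && Nat.beq (countLength 6 l) t.b &&
    isGrowable v t.n₁ 1 l && isGrowable v t.n₆ 6 l && isGrowable v t.n₁₈ 18 l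

theorem stepLength_eq (d : ℕ) : stepLength d = 1 ∨ stepLength d = 6 ∨ stepLength d = 18 := by
  unfold stepLength
  cases Nat.ble d 1 <;> cases Nat.ble d 3 <;> simp

theorem testBit_mask (l : List ℕ) (i : ℕ) : (mask l).testBit i ↔ i ∈ l := by
  induction l with
  | nil => simp [mask]
  | cons x l ih =>
    rw [mask, Nat.testBit_or, Bool.or_eq_true, ih, Nat.testBit_two_pow, List.mem_cons,
      decide_eq_true_iff, eq_comm (a := x)]

theorem eq_range_of_isRange {l : List ℕ} {k : ℕ} (h : isRange l k) :
    (l : Multiset ℕ) = Multiset.range k := by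
  simp only [isRange, Bool.and_eq_true, Nat.beq_eq] at h
  obtain ⟨h₁, h₂⟩ := h
  -- Every number below `k` occurs in `l`, and `l` is no longer than `k`.
  refine (Multiset.eq_of_le_of_card_le ((Multiset.le_iff_subset (Multiset.nodup_range k)).2
    fun i hi => ?_) (by simp [h₁])).symm
  rw [Multiset.mem_coe, ← testBit_mask, h₂, Nat.testBit_two_pow_sub_one]
  simpa using hi

theorem isArc_forward {v u d : ℕ} (hv : 18 < v) (hu : u < v) (hd : d % 2 = 0) :
    IsArc v u (stepLength d) (next v u d) := by
  have h := stepLength_eq d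
  refine ⟨h, hu, ?_, ?_⟩ <;>
    simp only [next, hd, Nat.beq_refl, Bool.cond_eq_ite, Nat.ble_eq, if_true] <;>
    split_ifs <;> omega

theorem isArc_backward {v u d : ℕ} (hv : 18 < v) (hu : u < v) (hd : d % 2 ≠ 0) :
    IsArc v (next v u d) (stepLength d) u := by
  have h := stepLength_eq d
  have : Nat.beq (d % 2) 0 = false := by rw [← Bool.not_eq_true, Nat.beq_eq]; exact hd
  refine ⟨h, ?_, hu, ?_⟩ <;>
    simp only [next, this, Bool.cond_eq_ite, Nat.ble_eq, Bool.false_eq_true, if_false] <;>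
    split_ifs <;> omega

theorem arcWalk {v : ℕ} (hv : 18 < v) (k : ℕ) {u : ℕ} (hu : u < v) (s : ℕ) :
    ArcWalk v u (vertices v k u s) (arcs v k u s) := by
  induction k generalizing u s with
  | zero => exact .nil hu
  | succ k ih =>
    simp only [vertices, arcs, force_eq]
    rw [← Multiset.cons_coe]
    by_cases hd : s % 6 % 2 = 0
    · have h := isArc_forward hv hu hd
      rw [hd]
      exact .forward h (ih h.right_lt _)
    · have h := isArc_backward hv hu hd
      rw [show Nat.beq (s % 6 % 2) 0 = false by rw [← Bool.not_eq_true, Nat.beq_eq]; exact hd]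
      exact .backward h (ih h.left_lt _)

theorem coe_slotList (v n y : ℕ) (l : List (ℕ × ℕ)) :
    (slotList v n y l : Multiset ℕ) = slots v n y l := by
  unfold slots
  induction l with
  | nil => rfl
  | cons e l ih =>
    rw [← Multiset.cons_coe, Multiset.cons_bind, ← ih, slotList, arcSlot, ahead]
    simp only [Bool.cond_eq_ite, Nat.ble_eq]
    split_ifs <;> first | omega | rfl

theorem growable_of_isGrowable {v n y : ℕ} {l : List (ℕ × ℕ)} (h : isGrowable v n y l)
    (hn : n < v) :
    Growable v n y l := by
  refine ⟨hn, ?_⟩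
  rw [isGrowable, Bool.or_eq_true, Nat.ble_eq] at h
  rw [← coe_slotList, eq_range_of_isRange (h.resolve_left (by omega))]

theorem map_snd_arcs (v k u s : ℕ) :
    ((arcs v k u s : Multiset (ℕ × ℕ)).map Prod.snd) =
      lengths (countLength 1 (arcs v k u s)) (countLength 6 (arcs v k u s))
        (k - countLength 1 (arcs v k u s) - countLength 6 (arcs v k u s)) ∧
      countLength 1 (arcs v k u s) + countLength 6 (arcs v k u s) ≤ k := by
  induction k generalizing u s with
  | zero => simp [arcs, countLength, lengths]
  | succ k ih =>
    simp only [arcs, force_eq]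
    rw [← Multiset.cons_coe, Multiset.map_cons]
    obtain ⟨h₁, h₂⟩ := ih (next v u (s % 6)) (s / 6)
    rw [h₁]
    set l := arcs v k (next v u (s % 6)) (s / 6)
    rcases stepLength_eq (s % 6) with h | h | h <;> simp only [countLength, h] <;>
      simp only [Nat.beq, cond_true, cond_false, lengths]
    · refine ⟨?_, by omega⟩
      rw [show k + 1 - (countLength 1 l + 1) = k - countLength 1 l by omega,
        Multiset.replicate_succ, Multiset.cons_add, Multiset.cons_add]
    · refine ⟨?_, by omega⟩
      rw [show k + 1 - countLength 1 l - (countLength 6 l + 1) =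
        k - countLength 1 l - countLength 6 l by omega,
        Multiset.replicate_succ, Multiset.add_cons, Multiset.cons_add]
    · refine ⟨?_, by omega⟩
      rw [show k + 1 - countLength 1 l - countLength 6 l =
        k - countLength 1 l - countLength 6 l + 1 by omega,
        Multiset.replicate_succ, Multiset.add_cons]

theorem attains_of_check {t : Certificate} (h : t.check) :
    18 ≤ t.a + t.b + t.c ∧ Attains t.a t.b t.c (Nat.blt t.n₁ (t.a + t.b + t.c + 1))
      (Nat.blt t.n₆ (t.a + t.b + t.c + 1)) (Nat.blt t.n₁₈ (t.a + t.b + t.c + 1)) := by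
  simp only [check, Bool.and_eq_true, Nat.ble_eq, Nat.beq_eq] at h
  obtain ⟨⟨⟨⟨⟨⟨hv, hr⟩, ha⟩, hb⟩, h₁⟩, h₆⟩, h₁₈⟩ := h
  refine ⟨by omega, arcs _ (t.a + t.b + t.c) 0 t.steps,
    ⟨_, _, arcWalk (by omega) _ (by omega) _, eq_range_of_isRange hr⟩, ?_,
    fun h => ⟨_, growable_of_isGrowable h₁ (Nat.ble_eq.mp h)⟩,
    fun h => ⟨_, growable_of_isGrowable h₆ (Nat.ble_eq.mp h)⟩,
    fun h => ⟨_, growable_of_isGrowable h₁₈ (Nat.ble_eq.mp h)⟩⟩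
  rw [(map_snd_arcs _ _ _ _).1, ha, hb]
  congr 1; omega

/-! ### The list of paths -/

/-- The certificates with `b ≡ 0` modulo `6`, listed by the residue of `c` modulo `18`. -/
def certificates_zero : List (List Certificate) := [
  [⟨4, 6, 18, 99, 99, 13, 0x10a334e09dcf948a720⟩,
   ⟨4, 12, 18, 34, 29, 17, 0xb125e5eefd2897f06ec6d4⟩,
   ⟨6, 6, 18, 99, 99, 20, 0x1d88bcfa358bb1b520e3⟩,
   ⟨10, 6, 18, 17, 23, 0, 0xddceafcdc4bdb5ac10b5b7⟩],
  [⟨3, 6, 19, 99, 99, 3, 0xd2d4e8e2eb5c7fd5c0⟩,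
   ⟨3, 12, 19, 99, 25, 11, 0xdda25b597a492d54e0855c⟩,
   ⟨3, 18, 1, 99, 2, 99, 0x1325d04fa7c97be⟩,
   ⟨5, 6, 19, 99, 99, 1, 0x21cf55e807b2a4f59414⟩,
   ⟨5, 12, 1, 13, 8, 99, 0x2499cff5dba9⟩,
   ⟨5, 12, 19, 36, 5, 17, 0x19cfebb316b09652c642d76c⟩,
   ⟨9, 6, 19, 99, 3, 19, 0xbd98e56577133742272e37⟩,
   ⟨11, 6, 1, 1, 16, 99, 0x31b3401eb467⟩,
   ⟨11, 6, 19, 36, 5, 17, 0x1802b7461dfbbfc89fae33bc⟩],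
  [⟨2, 6, 20, 99, 99, 1, 0x147f47aee5d06fe682c⟩,
   ⟨2, 12, 20, 99, 24, 7, 0xd7682e120954daffbf1960⟩,
   ⟨2, 18, 2, 99, 7, 99, 0x1b470a04a1ae0c8⟩,
   ⟨4, 6, 20, 99, 99, 25, 0x25724a253077d3579055⟩,
   ⟨4, 12, 20, 99, 25, 13, 0x15a49b771156c37bf1d675f4⟩,
   ⟨4, 18, 2, 24, 5, 99, 0x1a433b3cb792f942⟩,
   ⟨8, 6, 20, 99, 11, 34, 0xaa6443e7b2488020936ae5⟩,
   ⟨10, 6, 2, 17, 12, 99, 0x247009f70eed⟩,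
   ⟨10, 6, 20, 36, 5, 17, 0x1701fb0ea89b03f8822f33bc⟩],
  [⟨1, 6, 21, 99, 99, 24, 0x14c54de2eb9e79bb9bf⟩,
   ⟨1, 12, 21, 99, 24, 7, 0xddef4a2930efb87a1fa8a4⟩,
   ⟨1, 18, 3, 99, 16, 99, 0xbb2bcb0087a4e1⟩,
   ⟨3, 6, 21, 99, 99, 1, 0x2e1ee3b0175f48a878ac⟩,
   ⟨3, 12, 3, 99, 4, 99, 0x43bc2ffd9e01⟩,
   ⟨3, 12, 21, 99, 0, 21, 0x18e97c3911c19c8ab1c1c870⟩,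
   ⟨5, 12, 3, 5, 20, 99, 0x55c16efd72c49⟩,
   ⟨7, 6, 21, 99, 2, 26, 0xb0c6ef237708ffe322d10b⟩,
   ⟨9, 6, 21, 99, 8, 29, 0x1aa93d19bf900dc108bae613⟩,
   ⟨10, 6, 21, 33, 1, 14, 0x9b301602f695b51b2aa2abc8⟩,
   ⟨11, 6, 3, 18, 3, 99, 0x9575afeb84cf4⟩],
  [⟨2, 6, 22, 99, 99, 1, 0x256afd422ca3634e5a4c⟩,
   ⟨2, 12, 4, 99, 13, 99, 0x53fc970ba172⟩,
   ⟨2, 12, 22, 99, 27, 13, 0x213e7f2017e9581f1db5e39c⟩,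
   ⟨5, 12, 4, 2, 8, 99, 0x4608c149b258a1⟩,
   ⟨6, 6, 22, 99, 20, 2, 0xd1224e705f364b98b2d624⟩,
   ⟨8, 6, 22, 99, 25, 6, 0x1d6b3c7be76e0c8e77b912b6⟩,
   ⟨10, 6, 4, 14, 10, 99, 0x8f7d7f9f2811c⟩,
   ⟨10, 6, 22, 5, 0, 23, 0x4aefc9e348c98e2cacdc569a3⟩],
  [⟨1, 6, 23, 99, 99, 29, 0x2507a225c2dc98d64aff⟩,
   ⟨1, 12, 5, 99, 8, 99, 0x2261da750562⟩,
   ⟨1, 12, 23, 99, 15, 0, 0x1a9d90fc934da2cfdcf04db1⟩,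
   ⟨5, 6, 23, 99, 33, 16, 0xddcac05e13ad5096f4bbe6⟩,
   ⟨5, 12, 5, 3, 22, 99, 0x897e9d30928ca9⟩,
   ⟨7, 6, 23, 99, 8, 28, 0x170f534c7a69653aa73586c1⟩,
   ⟨10, 6, 23, 1, 36, 19, 0x18c6ddf243ee81f0e4157232c3⟩,
   ⟨16, 0, 5, 3, 21, 99, 0xf964ede221be5⟩],
  [⟨4, 6, 24, 99, 99, 23, 0xd7ee2347c5d198626101ff⟩,
   ⟨4, 12, 24, 99, 7, 31, 0x7817a4fc86576e98446d5a3715⟩,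
   ⟨4, 18, 6, 3, 27, 99, 0x89f49146494433f7c9⟩,
   ⟨6, 6, 24, 99, 30, 11, 0x1d6e465ac4f9f23990eac800⟩,
   ⟨10, 6, 24, 13, 19, 31, 0xa4a55918834b5f6b107977229b⟩,
   ⟨16, 0, 6, 7, 1, 99, 0x142d0fb4ab44333⟩],
  [⟨3, 6, 25, 99, 99, 10, 0xbcb7849d4c96d191d88ee6⟩,
   ⟨3, 12, 7, 99, 19, 99, 0x15303d62b63c122⟩,
   ⟨3, 12, 25, 99, 2, 20, 0x4c7a542ef9ba198b873200126d⟩,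
   ⟨5, 6, 25, 99, 99, 28, 0x17166d09043239959ab15b3f⟩,
   ⟨5, 12, 7, 24, 5, 99, 0x279f505e5f10ee2a⟩,
   ⟨5, 12, 25, 14, 20, 32, 0x17817253af2fdf5122ce466ff1c1⟩,
   ⟨9, 6, 25, 99, 99, 38, 0xa82a2224557cb46892becd76af⟩,
   ⟨10, 6, 25, 11, 17, 29, 0x3e4d42d2be7b14886552a0b17f7⟩,
   ⟨16, 0, 7, 7, 13, 99, 0x957dfb5565e0b33⟩],
  [⟨2, 6, 26, 99, 99, 25, 0xab2a1c6628bddb3f6c38b5⟩,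
   ⟨2, 12, 8, 99, 4, 99, 0xe49d368fd9793f⟩,
   ⟨2, 12, 26, 99, 9, 27, 0x796c906a69aca6178577ff7ab7⟩,
   ⟨4, 6, 26, 99, 99, 27, 0x14b35b7321f1e9a8c4d1b73b⟩,
   ⟨4, 12, 8, 2, 21, 99, 0x1b2234477c762081⟩,
   ⟨4, 12, 26, 28, 23, 4, 0x12e2e6e0f1f6747109de4e5943d2⟩,
   ⟨8, 6, 26, 99, 99, 2, 0xa89bd0bbd4aae760137bf613cc⟩,
   ⟨10, 6, 26, 1, 39, 25, 0x143a864f193812ca72bdfd282f7b⟩,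
   ⟨16, 0, 8, 17, 23, 99, 0x39f037bfffbbbc00⟩],
  [⟨1, 6, 27, 99, 99, 1, 0xcac38bc27fe524f323e030⟩,
   ⟨1, 12, 9, 99, 10, 99, 0xbbcc4cab89f5b3⟩,
   ⟨1, 12, 27, 99, 39, 22, 0xa8ac76a143aa17b6c937d4f35c⟩,
   ⟨3, 6, 27, 99, 99, 8, 0x14b35b7321f1e9a8c4d1b74c⟩,
   ⟨3, 12, 9, 99, 22, 99, 0x1af80566b8d15c21⟩,
   ⟨3, 12, 27, 99, 1, 14, 0x175e9539d1543f841f7cff9592f0⟩,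
   ⟨4, 12, 9, 23, 3, 99, 0xbf48566c633588a2⟩,
   ⟨6, 12, 27, 35, 30, 13, 0xfd8dc8feedd20e21fb35a6acc2874⟩,
   ⟨7, 6, 27, 99, 99, 19, 0x86f993c205aef85b0f7c32d397⟩,
   ⟨9, 6, 27, 99, 99, 6, 0x144c84a18c9179674da9d3a2297c⟩,
   ⟨10, 6, 9, 3, 24, 99, 0x163ec9d1b7dc5b6a3⟩,
   ⟨10, 6, 27, 31, 26, 5, 0x70075e32935865f610489b092d56⟩],
  [⟨2, 6, 28, 99, 99, 33, 0x21534df8aea1e189462c30af⟩,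
   ⟨2, 12, 10, 99, 5, 99, 0x1af98652bdbe77c6⟩,
   ⟨2, 12, 28, 99, 35, 10, 0x163007b744ef609f4d565aef5164⟩,
   ⟨4, 12, 10, 22, 1, 99, 0x717eed9360ecd5efa⟩,
   ⟨4, 12, 28, 5, 0, 38, 0x321dd478d2b2879603888c897c8cb⟩,
   ⟨6, 6, 28, 99, 99, 31, 0x859234aa855a0466ed10ed465b⟩,
   ⟨8, 6, 28, 99, 99, 25, 0x144c84a18c917972a83e2a487093⟩,
   ⟨10, 6, 28, 1, 41, 19, 0x321a509ae637a09512163fe6a628b⟩,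
   ⟨16, 0, 10, 17, 23, 99, 0x825c7d6fe4d053700⟩],
  [⟨1, 6, 29, 99, 99, 2, 0x21517a7618b0c4a080724c00⟩,
   ⟨1, 12, 11, 99, 14, 99, 0x3d93dd3b94b1cc10⟩,
   ⟨1, 12, 29, 99, 39, 24, 0xec17ca52cd40285161a028743b0⟩,
   ⟨4, 12, 11, 15, 21, 99, 0x31e560a83a0e55e43f⟩,
   ⟨4, 12, 29, 41, 1, 19, 0xfef7e279df6e40b7f3cd72f5febf0⟩,
   ⟨5, 6, 29, 99, 99, 1, 0xa41984da38285024d829332ecc⟩,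
   ⟨7, 6, 29, 99, 99, 25, 0x17a26d63a174d3924308478418f3⟩,
   ⟨10, 6, 11, 27, 22, 99, 0x280783c4305f8da542⟩,
   ⟨10, 6, 29, 29, 24, 1, 0xfa9688c4b606680577b55932af620⟩],
  [⟨4, 6, 30, 99, 99, 12, 0xa4a55cb1e589cd6232532fc7e0⟩,
   ⟨4, 12, 12, 16, 11, 5, 0xff8624d2feae690028⟩,
   ⟨6, 6, 12, 99, 0, 19, 0x297402c97e6c27b3⟩,
   ⟨10, 6, 12, 22, 17, 11, 0xe62e22b23840dc2c38⟩],
  [⟨3, 6, 13, 99, 99, 5, 0x12723b9754a379c⟩,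
   ⟨3, 12, 13, 99, 28, 22, 0xff8624d2fe5306ad51⟩,
   ⟨5, 6, 13, 99, 16, 9, 0x3be3a5846646f9c8⟩,
   ⟨9, 6, 13, 99, 18, 1, 0x11bcd2bdd31a3123634⟩,
   ⟨10, 6, 13, 29, 24, 17, 0x56305e9a0a057b97c7a⟩],
  [⟨2, 6, 14, 99, 99, 3, 0x17006319c339ac4⟩,
   ⟨2, 12, 14, 99, 1, 22, 0xf786c842b69c158551⟩,
   ⟨4, 6, 14, 99, 99, 1, 0x40928ebeaaf65374⟩,
   ⟨4, 12, 14, 1, 27, 20, 0x1d71b1bba3b966975e1f⟩,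
   ⟨8, 6, 14, 99, 17, 10, 0xe5d4a23ee79f9d976c⟩,
   ⟨10, 6, 14, 3, 29, 21, 0x27fbc087b0e06339bee5⟩],
  [⟨1, 6, 15, 99, 99, 1, 0x1280bea32e5ef4c⟩,
   ⟨1, 12, 15, 99, 23, 14, 0xd25a0f1f7b518da602⟩,
   ⟨3, 6, 15, 99, 99, 24, 0x40a4389e7e41d25f⟩,
   ⟨3, 12, 15, 99, 3, 25, 0x22d9735bba7e72dd85af⟩,
   ⟨7, 6, 15, 99, 7, 20, 0xef5766d085b8c3c44d⟩,
   ⟨9, 6, 15, 99, 29, 12, 0x293fd2e12d02a3097958⟩,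
   ⟨10, 6, 15, 1, 28, 19, 0x10717f13b4c69bd439f65⟩],
  [⟨2, 6, 16, 99, 99, 1, 0x41a57cc7a0dd5374⟩,
   ⟨2, 12, 16, 99, 19, 12, 0x2aa43ef96058f2383aa2⟩,
   ⟨4, 12, 16, 32, 27, 17, 0x50d0147b535ea93f8c074⟩,
   ⟨6, 6, 16, 99, 99, 19, 0x125e25d3251cbcd8925⟩,
   ⟨8, 6, 16, 99, 4, 25, 0x249f6011802b8304ee65⟩,
   ⟨10, 6, 16, 32, 28, 17, 0x4e930143f4c2b6c4a68f8⟩],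
  [⟨1, 6, 17, 99, 99, 11, 0x41c1facbef2106ec⟩,
   ⟨1, 12, 17, 99, 15, 3, 0x2bda29ea33d5638b2564⟩,
   ⟨4, 12, 17, 17, 12, 1, 0x1d8650fd2a316ea8127168⟩,
   ⟨5, 6, 17, 99, 99, 7, 0x1396801a3b5dce88108⟩,
   ⟨7, 6, 17, 99, 99, 12, 0x2ea05733b6efd1e08460⟩,
   ⟨10, 6, 17, 3, 33, 21, 0x21c720769fd6ac42c9590f⟩]]

/-- The certificates with `b ≡ 1` modulo `6`, listed by the residue of `c` modulo `18`. -/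
def certificates_one : List (List Certificate) := [
  [⟨3, 1, 18, 99, 99, 20, 0x1d39cf8fecc7a6f⟩,
   ⟨3, 7, 18, 99, 99, 5, 0xf7d1d5b3b1bed13188⟩,
   ⟨3, 13, 18, 99, 7, 24, 0xb7969717614a30c8432b01⟩,
   ⟨5, 1, 18, 99, 99, 19, 0x402c9e3647b1dc03⟩,
   ⟨5, 7, 18, 99, 99, 15, 0x24a02165577f9aab4724⟩,
   ⟨5, 13, 18, 34, 3, 17, 0x185e7a7ef5751ed01e5cc074⟩,
   ⟨9, 1, 18, 99, 99, 12, 0xe65ad5c772f579af78⟩,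
   ⟨9, 7, 18, 5, 0, 23, 0xd73956f2d16911d99341e5⟩,
   ⟨11, 1, 18, 99, 24, 12, 0x2de6afa82c1277d5dc38⟩,
   ⟨15, 1, 18, 10, 16, 28, 0xcaa4cfa91745610324d2a3⟩],
  [⟨2, 1, 19, 99, 99, 1, 0x1d39d03a13075fa⟩,
   ⟨2, 7, 19, 99, 99, 9, 0x10a491eb11409110a5c⟩,
   ⟨2, 13, 19, 99, 24, 14, 0xecede4fa0ed225cae076f6⟩,
   ⟨2, 19, 1, 99, 1, 99, 0xbb0bb26197ba26⟩,
   ⟨4, 1, 19, 99, 99, 1, 0x41c03ac65506e1cc⟩,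
   ⟨4, 7, 19, 99, 99, 14, 0x2438ed1518d16f403c8c⟩,
   ⟨4, 13, 1, 5, 0, 99, 0x26508d586325⟩,
   ⟨4, 13, 19, 32, 1, 15, 0x19dd6c6525bf53963782b6d4⟩,
   ⟨8, 1, 19, 99, 99, 22, 0x10752cc0c14e31bbe75⟩,
   ⟨8, 7, 19, 99, 18, 6, 0xec6628726b6e755c76e08c⟩,
   ⟨10, 1, 19, 99, 99, 22, 0x2807ee83a835cd66f13b⟩,
   ⟨10, 7, 1, 18, 5, 99, 0x2499b8615124⟩,
   ⟨10, 7, 19, 3, 35, 23, 0x1d706a8c1a7eed0e9c56c677⟩,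
   ⟨14, 1, 19, 99, 15, 27, 0xaa60ecd7b0e0f8d5d45fe5⟩,
   ⟨16, 1, 1, 6, 99, 99, 0x40a8639969e0⟩,
   ⟨16, 1, 19, 36, 5, 17, 0x3d5a9672e677f01fa60903c⟩],
  [⟨1, 1, 20, 99, 99, 7, 0x1761764d162034c⟩,
   ⟨1, 7, 20, 99, 99, 25, 0x10a454423362398c2bf⟩,
   ⟨1, 13, 20, 99, 24, 13, 0xd7308510eaa97e8250b6a2⟩,
   ⟨1, 19, 2, 99, 7, 99, 0x11a4ce9b6067080⟩,
   ⟨3, 1, 20, 99, 99, 19, 0x41c21cb8d1daa747⟩,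
   ⟨3, 7, 20, 99, 99, 3, 0x2ecb8232488edafe1274⟩,
   ⟨3, 13, 2, 99, 16, 99, 0x2432f96b8549⟩,
   ⟨3, 13, 20, 99, 19, 7, 0x16cd1654c6990066335e30a2⟩,
   ⟨5, 13, 2, 13, 7, 99, 0x525a150120c7c⟩,
   ⟨7, 1, 20, 99, 99, 19, 0x14cb884e7a967b4c693⟩,
   ⟨7, 7, 20, 99, 23, 12, 0xd0fdc137c8a14bb4a16c36⟩,
   ⟨9, 1, 20, 99, 99, 22, 0x2952a29be176958de235⟩,
   ⟨9, 7, 2, 6, 12, 99, 0x128ad6175f34⟩,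
   ⟨9, 7, 20, 32, 1, 13, 0x1715e88ada4e7f4189cb4474⟩,
   ⟨13, 1, 20, 99, 7, 19, 0xbd98f6321d4c7c60b11fd3⟩,
   ⟨15, 1, 2, 12, 99, 99, 0x59cd6de342d3⟩,
   ⟨15, 1, 20, 36, 5, 17, 0x1701f86bdd9449b74eb1203c⟩],
  [⟨2, 1, 21, 99, 99, 0, 0x349b196d86f7183f⟩,
   ⟨2, 7, 21, 99, 99, 22, 0x2ecb8232488edb01cc6f⟩,
   ⟨2, 13, 3, 99, 1, 99, 0x3b3f1c4209a5⟩,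
   ⟨2, 13, 21, 99, 19, 7, 0x20fc0de68d61aff2335e30a2⟩,
   ⟨4, 13, 3, 8, 3, 99, 0x525a157f8d835⟩,
   ⟨6, 1, 21, 99, 99, 1, 0x14ce66da21b29bcff28⟩,
   ⟨6, 7, 21, 99, 5, 29, 0xbce2d3c3826c6281f368e3⟩,
   ⟨8, 1, 21, 99, 99, 19, 0x2ea059d6c6cb5f6ea2bf⟩,
   ⟨8, 7, 21, 99, 0, 19, 0x1d6b3c7be76e0be42b084261⟩,
   ⟨10, 7, 3, 15, 1, 99, 0x4e8837120fe4c⟩,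
   ⟨12, 1, 21, 99, 6, 26, 0xbd93d571bec01916d1d2a3⟩,
   ⟨14, 1, 21, 99, 26, 1, 0x1d5d49f0957c42456d03f504⟩,
   ⟨15, 1, 21, 32, 27, 16, 0x8a0bd282868ddd2abb1db4f6⟩,
   ⟨18, 1, 3, 16, 99, 99, 0x2ff453d7⟩],
  [⟨1, 1, 22, 99, 99, 2, 0x349b458f3088028c⟩,
   ⟨1, 7, 22, 99, 99, 29, 0x2bda26c29a9f813383af⟩,
   ⟨1, 13, 4, 99, 11, 99, 0x2a9a058a2049⟩,
   ⟨1, 13, 22, 99, 35, 22, 0x1e43d7faad6023d91a7d7baf⟩,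
   ⟨4, 13, 4, 19, 3, 99, 0x1e867b393b56fa⟩,
   ⟨5, 1, 22, 99, 99, 23, 0x144dc17dbd6300159af⟩,
   ⟨5, 7, 22, 99, 1, 19, 0xbce2d3c36c85b5109080ef⟩,
   ⟨7, 1, 22, 99, 99, 1, 0x2ea05acbb70dc5d37f28⟩,
   ⟨7, 7, 22, 99, 11, 30, 0x18e2e7432a449aa40addd381⟩,
   ⟨11, 1, 22, 99, 30, 12, 0x42b5d425542831a024d626⟩,
   ⟨13, 1, 22, 99, 31, 16, 0x2130effcdd35a9971263e48c⟩,
   ⟨15, 1, 4, 9, 5, 99, 0x8f7d23b79a9e0⟩,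
   ⟨15, 1, 22, 12, 18, 30, 0x498655b9da7575d33a324d2a3⟩],
  [⟨4, 1, 23, 99, 99, 23, 0x1043ddf8d9f30f06c67⟩,
   ⟨4, 7, 23, 99, 28, 17, 0xecfc57ec22cef8d247a90a⟩,
   ⟨4, 13, 5, 6, 1, 99, 0x1655aac76542ab5⟩,
   ⟨5, 13, 23, 28, 23, 4, 0x325d1257d93ab693949142d43d2⟩,
   ⟨6, 1, 23, 99, 99, 28, 0x25506054bf48c79cbb67⟩,
   ⟨6, 7, 23, 99, 99, 0, 0x172457083c09c917096f5657⟩,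
   ⟨10, 1, 23, 99, 5, 25, 0xaa61b29bbc2c17bc6dc7e5⟩,
   ⟨12, 1, 23, 99, 28, 9, 0x2153dd81e95bb9b19408f4f6⟩,
   ⟨15, 1, 5, 8, 14, 99, 0x44ab21b3a82733⟩,
   ⟨15, 1, 23, 32, 27, 10, 0x16210f9ca9231529cb0b29c4f6⟩],
  [⟨3, 1, 24, 99, 99, 19, 0x144e193039f2e8ae83f⟩,
   ⟨3, 7, 24, 99, 99, 26, 0x91c52d7c5fcaa978b29047⟩,
   ⟨3, 13, 6, 99, 16, 99, 0x11939337d5d449e⟩,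
   ⟨3, 13, 24, 99, 2, 20, 0x9e4bd37a3c2cbafd561f00fdac⟩,
   ⟨5, 1, 24, 99, 99, 1, 0x250fae8881d9adc63044⟩,
   ⟨5, 7, 24, 99, 27, 8, 0x1e5d80654ccae340cefc905c⟩,
   ⟨5, 13, 6, 18, 24, 99, 0x274ae2f5a44e22bc⟩,
   ⟨9, 1, 24, 99, 99, 6, 0xecf9aa9f34a3e8ffcb97cc⟩,
   ⟨9, 7, 24, 8, 14, 26, 0xa8a6a23eaa6f3c6fa4000e0a73⟩,
   ⟨11, 1, 24, 99, 35, 16, 0x2153dd812239bbb5ba35a216⟩,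
   ⟨15, 1, 6, 12, 18, 99, 0x19c018e1b26b2d3⟩,
   ⟨15, 1, 24, 1, 37, 19, 0x94a84651f4c50f7f7789763207⟩],
  [⟨2, 1, 25, 99, 99, 9, 0x14ce2aca75879c03fe0⟩,
   ⟨2, 7, 25, 99, 99, 17, 0x961919be0499eed1e04492⟩,
   ⟨2, 13, 7, 99, 14, 99, 0x15303d62b640a6b⟩,
   ⟨2, 13, 25, 99, 35, 11, 0x9f470e9f6d11ee11973cee9022⟩,
   ⟨4, 1, 25, 99, 99, 1, 0x249da21636ef3a4d7f68⟩,
   ⟨4, 7, 25, 99, 99, 17, 0x1804c1529cc2825ac94c3aa4⟩,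
   ⟨4, 13, 7, 10, 4, 99, 0x324dc015416d9e8d⟩,
   ⟨4, 13, 25, 40, 35, 29, 0x12e2e6e0f1f6747109de4e593afa⟩,
   ⟨8, 1, 25, 99, 99, 31, 0xa39c3cdf2fa741556788ff⟩,
   ⟨8, 7, 25, 99, 99, 2, 0xa8b4be7b8dc4411b946f5213cc⟩,
   ⟨10, 1, 25, 99, 0, 20, 0x2153e43866bd70535155bdc8⟩,
   ⟨14, 1, 25, 99, 9, 30, 0x248dd5145bb213dd6075ac5fe5⟩,
   ⟨15, 1, 7, 12, 18, 99, 0x957dfb5565e41e0⟩,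
   ⟨15, 1, 25, 3, 40, 21, 0x3dbf02d03eb396369f542e36a83⟩],
  [⟨1, 1, 26, 99, 99, 20, 0x14ce6b0405eff80d6ff⟩,
   ⟨1, 7, 26, 99, 99, 2, 0xbd625d768bbad406343072⟩,
   ⟨1, 13, 8, 99, 10, 99, 0x19cfebe3636ffb3⟩,
   ⟨1, 13, 26, 99, 4, 26, 0x82acae69811f0527efd2fc2af7⟩,
   ⟨3, 1, 26, 99, 99, 12, 0x2ed0676aad55dfa05bcc⟩,
   ⟨3, 7, 26, 99, 99, 20, 0x1a89ea0425ab50f230b57197⟩,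
   ⟨3, 13, 8, 99, 22, 99, 0x3d930d54368d9b82⟩,
   ⟨3, 13, 26, 99, 7, 29, 0x11cb68f6d7169603ca59aac20247⟩,
   ⟨4, 13, 8, 3, 23, 99, 0xf82790fb7722ab01⟩,
   ⟨5, 13, 26, 5, 0, 28, 0x34192eae7aaee78a2cf89aae5359f⟩,
   ⟨7, 1, 26, 99, 99, 33, 0xecf9abb0b0e1b057b324b5⟩,
   ⟨7, 7, 26, 99, 99, 13, 0x904fa68bc186e05ca62c1080f6⟩,
   ⟨9, 1, 26, 99, 99, 24, 0x2130f6e4740ce9e590855423⟩,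
   ⟨9, 7, 26, 99, 99, 19, 0x12b4cb79bbf376a4c75be5fcf8d7⟩,
   ⟨13, 1, 26, 99, 9, 30, 0x869cd21f197377a20135ac5fe5⟩,
   ⟨15, 1, 8, 24, 5, 99, 0x1279ead9bdc38⟩,
   ⟨15, 1, 26, 31, 26, 6, 0x128fa49cd08db608d7bb38284438⟩],
  [⟨2, 1, 27, 99, 99, 19, 0x25738d5d88f80540ccff⟩,
   ⟨2, 7, 27, 99, 99, 25, 0x1a5a2118239f9fdf03806cc7⟩,
   ⟨2, 13, 9, 99, 19, 99, 0x6d6e2a1fc18e571⟩,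
   ⟨2, 13, 27, 99, 1, 30, 0x12fa81b1116ba3a8b3f70e90f12f⟩,
   ⟨4, 13, 9, 26, 20, 99, 0x712ef02fd32f1ab82⟩,
   ⟨4, 13, 27, 40, 35, 19, 0x2a424c2a7cff357a70b84be593afa⟩,
   ⟨6, 1, 27, 99, 99, 29, 0x42b4f94c803767d1dfc60f⟩,
   ⟨6, 7, 27, 99, 99, 31, 0x867b6b5d0b1603a3faaa50c65b⟩,
   ⟨8, 1, 27, 99, 99, 4, 0x1d707d6ee9010daf13f95640⟩,
   ⟨8, 7, 27, 99, 99, 11, 0x15e9e03da831593fe9bce514b146⟩,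
   ⟨9, 7, 27, 14, 20, 36, 0x8c36d1c13e3d2137c4f255465e65⟩,
   ⟨12, 1, 27, 99, 99, 36, 0x74c0486969414553b809fb4997⟩,
   ⟨14, 1, 27, 99, 99, 9, 0x1443a32199e2af58de447f30b526⟩,
   ⟨15, 1, 27, 32, 99, 12, 0x6246eaf14b2d212eb67a9a1eb4f6⟩,
   ⟨16, 1, 9, 22, 17, 99, 0x66259eef4a0fafef6⟩],
  [⟨1, 1, 28, 99, 99, 25, 0x2ed070f29e2dcf1297ff⟩,
   ⟨1, 7, 28, 99, 99, 17, 0x1aa95e1354d1bd18dbbe22c4⟩,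
   ⟨1, 13, 10, 99, 12, 99, 0x20b373096bb3445b⟩,
   ⟨1, 13, 28, 99, 36, 17, 0x16468a676df6411d44cf4c7ec26c⟩,
   ⟨4, 13, 10, 25, 3, 99, 0x216e775c69f6a507be⟩,
   ⟨5, 1, 28, 99, 99, 27, 0xcac2c18d9bedd1d1dfc60f⟩,
   ⟨5, 7, 28, 99, 99, 1, 0x9f41a252dd6e56505e7b588fac⟩,
   ⟨5, 13, 28, 41, 36, 16, 0x5f9cf35da88f97242cf05b46c1ecc4⟩,
   ⟨7, 1, 28, 99, 99, 23, 0x1d707d6ee9010daf13f9565f⟩,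
   ⟨7, 7, 28, 99, 99, 12, 0x17b8416dfe805f362f61884422cc⟩,
   ⟨11, 1, 28, 99, 8, 26, 0x86769b43f110380da4d1ae188f⟩,
   ⟨13, 1, 28, 99, 4, 31, 0x1122c1a73f0c23fdefebf3ba6208⟩,
   ⟨15, 1, 10, 1, 23, 99, 0x1d9805a57b632daa3⟩,
   ⟨15, 1, 28, 44, 5, 21, 0x24da97fc479f0494c4c41f3605ea4⟩],
  [⟨4, 1, 29, 99, 99, 12, 0xcac39c67a3836ed5ff07e6⟩,
   ⟨4, 7, 29, 99, 99, 7, 0xa6f0b8d234564809ba774bb172⟩,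
   ⟨4, 13, 11, 26, 21, 99, 0xf8ace142ad35985b42⟩,
   ⟨4, 13, 29, 44, 3, 19, 0x5f9cf4e7e4bcefaddcedbe8398cd22⟩,
   ⟨6, 1, 29, 99, 99, 22, 0x1aa98386841dd315d0f86517⟩,
   ⟨6, 7, 29, 99, 99, 3, 0x12c7e11a88e5c81ed4ae92be4f1c⟩,
   ⟨9, 7, 29, 45, 5, 17, 0xfc1091e15ba20f9d8c93b72ea55e8⟩,
   ⟨10, 1, 29, 99, 30, 7, 0x95098d2e39a2becba3c61b6eb8⟩,
   ⟨12, 1, 29, 99, 99, 25, 0x3f3c8335b7d28ffb321eed14a7f⟩,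
   ⟨15, 1, 29, 42, 99, 14, 0xdd1f8fe2363c04dc2b3ac20825ea4⟩,
   ⟨16, 1, 11, 28, 5, 99, 0xef545f6f6c2fad3038⟩],
  [⟨3, 1, 30, 99, 99, 8, 0xbd98fca1f0f0b79e7ee3e6⟩,
   ⟨3, 7, 30, 99, 99, 12, 0x8566b68fb7ff272332532fc7e0⟩,
   ⟨3, 13, 12, 99, 9, 3, 0x12c4fce0c10d7e80028⟩,
   ⟨5, 1, 30, 99, 99, 29, 0x1d708139e8d69f2ed205fb85⟩,
   ⟨5, 7, 12, 99, 12, 6, 0x2981029c908ca52c⟩,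
   ⟨9, 1, 30, 99, 99, 1, 0x9505f48fce309142d37b869d74⟩,
   ⟨9, 7, 12, 3, 27, 21, 0xccd06585ea553c3ba3⟩,
   ⟨11, 1, 30, 99, 13, 1, 0x14e7a9e3e0fbe94eed05147e9fdc⟩,
   ⟨15, 1, 12, 1, 25, 99, 0x35f1439cb7eff2daa3⟩,
   ⟨15, 1, 30, 12, 18, 30, 0x75c5ba8409d2d4ff28d2ad787e72a3⟩],
  [⟨2, 1, 31, 99, 99, 25, 0xbd98fca1f0f0b79e7ee3ff⟩,
   ⟨2, 7, 13, 99, 99, 5, 0x1cc0802e28e379c⟩,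
   ⟨2, 13, 13, 99, 28, 22, 0x12c851699710776ce21⟩,
   ⟨4, 1, 31, 99, 99, 5, 0x2153e468b910f0ac2012cb4c⟩,
   ⟨4, 7, 13, 99, 11, 4, 0x3be3a5846646fbc4⟩,
   ⟨8, 1, 31, 99, 99, 1, 0x95091f9e1d50e27ac6f1bec720⟩,
   ⟨8, 7, 13, 99, 15, 8, 0xff68780233860211f0⟩,
   ⟨9, 7, 13, 25, 1, 13, 0x59c0c3e6c03088d7e7c⟩,
   ⟨10, 1, 31, 99, 36, 11, 0x17b5e96f8007b063bfe4d30c7038⟩,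
   ⟨14, 1, 31, 99, 40, 21, 0x780882e19aeec46f1f6417f056493c⟩,
   ⟨15, 1, 13, 24, 0, 99, 0x6a6cf05e9e85c53dc38⟩,
   ⟨15, 1, 31, 41, 99, 10, 0x1f18705658c9477fc7bccac27e0dea4⟩],
  [⟨1, 1, 32, 99, 99, 20, 0xbd98fc79258e4ec4bfffff⟩,
   ⟨1, 7, 14, 99, 99, 11, 0x175c7da2970fba0⟩,
   ⟨1, 13, 14, 99, 23, 14, 0xd25a0f1ebf49a97602⟩,
   ⟨3, 1, 32, 99, 99, 19, 0x1aa97fbc044d0a31164d57ff⟩,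
   ⟨3, 7, 14, 99, 99, 9, 0x41a57cb0fcc0f9c8⟩,
   ⟨3, 13, 14, 99, 10, 1, 0x2a945cec1642f6e8d414⟩,
   ⟨7, 1, 32, 99, 99, 14, 0x95091f9e1d50e27ac8ca68a2e0⟩,
   ⟨7, 7, 14, 99, 10, 23, 0xff687c3dda8182a9a5⟩,
   ⟨9, 1, 32, 99, 99, 8, 0x171435ea37a3e2b6e3133680bacc⟩,
   ⟨9, 7, 14, 1, 27, 19, 0x29489c36ef503900b3a5⟩,
   ⟨13, 1, 32, 99, 24, 8, 0x7536b93d85ba75e3ac97ebb1cab370⟩,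
   ⟨15, 1, 14, 9, 4, 99, 0x20516dccda6a0ca05aa3⟩,
   ⟨15, 1, 32, 1, 45, 34, 0xee1ed6acfd7088903a69bb78f3acd43⟩],
  [⟨2, 1, 33, 99, 99, 24, 0x1aa98386841fbd2667d0257f⟩,
   ⟨2, 7, 15, 99, 99, 24, 0x299b17927aedbce3⟩,
   ⟨2, 13, 15, 99, 28, 12, 0x1d34447ad8dea2383aa2⟩,
   ⟨6, 1, 33, 99, 99, 10, 0xa89b3867b3c3d50d7261325bac⟩,
   ⟨6, 7, 15, 99, 18, 9, 0xd2567796e0f4e86aa0⟩,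
   ⟨8, 1, 33, 99, 99, 0, 0x17b94c0db6da26937e3608bcbbb7⟩,
   ⟨8, 7, 15, 99, 22, 5, 0x293fd2e12d1972ae0314⟩,
   ⟨9, 7, 15, 3, 30, 21, 0xefe5a9fd8f959677bce5⟩,
   ⟨12, 1, 33, 99, 99, 9, 0x77a20be5ff5915ddc58bee6d320828⟩,
   ⟨14, 1, 33, 99, 99, 39, 0x10d2c9ac533f7effc2764b1bc76e985f⟩,
   ⟨15, 1, 33, 15, 99, 33, 0x635ed55f684afb4b7d0d8e8fd99d4c23⟩,
   ⟨16, 1, 15, 28, 21, 99, 0x57c9c894b0e0271d8b6f6⟩],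
  [⟨1, 1, 34, 99, 99, 32, 0x1aa98383bbbe30a8e57fffff⟩,
   ⟨1, 7, 16, 99, 99, 23, 0x3483b74ec66f984b⟩,
   ⟨1, 13, 16, 99, 1, 16, 0x2438d8bd582cfb89e374⟩,
   ⟨4, 13, 16, 29, 24, 18, 0x1d8650fd2a314f262cb982⟩,
   ⟨5, 1, 16, 99, 99, 22, 0x8c40a57d71de97⟩,
   ⟨5, 7, 16, 99, 99, 20, 0x1477e1d0e949108c3b1⟩,
   ⟨7, 1, 16, 99, 99, 1, 0x337141c89966491a⟩,
   ⟨7, 7, 16, 99, 9, 1, 0x206f70dac9c833b255d2⟩,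
   ⟨11, 1, 16, 99, 1, 13, 0x105f9b85c507694dc38⟩,
   ⟨13, 1, 16, 99, 6, 18, 0x249fb97f076521fadf0e⟩,
   ⟨15, 1, 16, 14, 20, 32, 0x5cce584ce8a1924cb7f65⟩],
  [⟨4, 1, 17, 99, 99, 5, 0x8c40a5cfa85374⟩,
   ⟨4, 7, 17, 99, 99, 2, 0x13981c24153925a46dc⟩,
   ⟨4, 13, 17, 34, 29, 22, 0xb125e5ef066b60df0ac6d4⟩,
   ⟨6, 1, 17, 99, 99, 3, 0x3a10107a26b59d1c⟩,
   ⟨6, 7, 17, 99, 99, 22, 0x27fbb5ac9b5b951691b1⟩,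
   ⟨9, 7, 17, 0, 5, 17, 0x1e976310b087f3aa79e364⟩,
   ⟨10, 1, 17, 99, 99, 5, 0x125501a43377b68c228⟩,
   ⟨12, 1, 17, 99, 13, 25, 0x21abf1d933947989f7e5⟩,
   ⟨15, 1, 17, 19, 99, 3, 0x1b44b4ca4c86d10a66bef6⟩]]

/-- The certificates with `b ≡ 2` modulo `6`, listed by the residue of `c` modulo `18`. -/
def certificates_two : List (List Certificate) := [
  [⟨2, 2, 18, 99, 99, 22, 0x127fcbf8dd6b947⟩,
   ⟨2, 8, 18, 99, 99, 6, 0x1496304cd25dbc88dc4⟩,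
   ⟨2, 14, 18, 99, 31, 19, 0xea8e98d9fb29921e24738a⟩,
   ⟨4, 2, 18, 99, 99, 2, 0x3469e88313d5359c⟩,
   ⟨4, 8, 18, 99, 8, 1, 0x2e5520ed7b7675d2c1f6⟩,
   ⟨8, 2, 18, 99, 99, 3, 0xe65b683d9aa091ff28⟩,
   ⟨8, 8, 18, 99, 21, 10, 0xec65a6f9361709edbfe4ac⟩,
   ⟨10, 2, 18, 99, 17, 5, 0x20516dcd9bfae4661fec⟩,
   ⟨14, 2, 18, 3, 33, 21, 0xca0d7340abf94963a226e5⟩],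
  [⟨1, 2, 19, 99, 99, 7, 0x1d39d03a30e034c⟩,
   ⟨1, 8, 19, 99, 99, 8, 0xf9a72c9e487d0ab182⟩,
   ⟨1, 14, 19, 99, 24, 14, 0x9329a0f05cce498250b6a2⟩,
   ⟨1, 20, 1, 99, 3, 99, 0x118918b9d59a2b0⟩,
   ⟨3, 2, 19, 99, 99, 22, 0x34265baed534268b⟩,
   ⟨3, 8, 19, 99, 18, 5, 0x2e51ecb8b05014cfcf94⟩,
   ⟨3, 14, 1, 99, 12, 99, 0x360c88df3a6e⟩,
   ⟨5, 14, 1, 9, 1, 99, 0x7c2ec063393b5⟩,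
   ⟨7, 2, 19, 99, 99, 10, 0x11ca7153240484d35bc⟩,
   ⟨7, 8, 19, 99, 17, 34, 0xb0f9b16110af997165ae8f⟩,
   ⟨9, 2, 19, 99, 99, 6, 0x2ec9d7db87fc819bc5f6⟩,
   ⟨9, 8, 1, 17, 12, 99, 0x22bc604af329⟩,
   ⟨9, 8, 19, 5, 36, 23, 0x1d63af35e650eff07baa6385⟩,
   ⟨13, 2, 19, 99, 6, 28, 0xaa61c630957a58f8395aa3⟩,
   ⟨15, 2, 1, 3, 99, 99, 0x40a8639aa4c3⟩,
   ⟨15, 2, 19, 5, 0, 26, 0x9488c7f441c387f25d8aea3⟩],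
  [⟨2, 2, 20, 99, 99, 5, 0x41c212e2fcc5db84⟩,
   ⟨2, 8, 20, 99, 99, 1, 0x2438ef92ef53e5c65030⟩,
   ⟨2, 14, 2, 99, 11, 99, 0x24f27f22ef0e⟩,
   ⟨2, 14, 20, 99, 14, 2, 0x18e96d0b41a469c7f32c3368⟩,
   ⟨4, 14, 2, 5, 0, 99, 0x7c6721e37a825⟩,
   ⟨6, 2, 20, 99, 99, 9, 0x105fd4029fd34413c20⟩,
   ⟨6, 8, 20, 99, 28, 14, 0xbce2d3c36c85b50f54c0ee⟩,
   ⟨8, 2, 20, 99, 99, 5, 0x255894cb3a6a952077a8⟩,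
   ⟨8, 8, 2, 16, 3, 99, 0x22bc7564b12e⟩,
   ⟨8, 8, 20, 7, 13, 25, 0x1f30e0c2f345d532b6c6d4b7⟩,
   ⟨12, 2, 20, 99, 16, 4, 0xbce2d37c6f7c4763a226fc⟩,
   ⟨14, 2, 2, 10, 99, 99, 0x2e2f69dee833⟩,
   ⟨14, 2, 20, 20, 15, 1, 0x1701f86b166db56b3185eba0⟩],
  [⟨1, 2, 21, 99, 99, 20, 0x41c21713d3dc68f3⟩,
   ⟨1, 8, 21, 99, 99, 4, 0x25724de5abd099aefd70⟩,
   ⟨1, 14, 3, 99, 12, 99, 0x5635da218bfa⟩,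
   ⟨1, 14, 21, 99, 12, 1, 0x1f4a72f05be43e51670fe8fc⟩,
   ⟨4, 14, 3, 18, 1, 99, 0x2f051cac323126⟩,
   ⟨5, 2, 21, 99, 99, 26, 0x1090eb36ec54eb26007⟩,
   ⟨5, 8, 21, 99, 14, 32, 0x995c99ea175c0e57fd2015⟩,
   ⟨5, 14, 21, 4, 10, 24, 0x94ecd90e51fd9a6a7a2ae49e89⟩,
   ⟨7, 2, 21, 99, 99, 2, 0x2ec9f70604f77b137f28⟩,
   ⟨7, 8, 21, 99, 99, 15, 0x1d707ee2ec39c18b3ed847f4⟩,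
   ⟨11, 2, 21, 99, 0, 20, 0xecf9aa9efe937e8f133663⟩,
   ⟨13, 2, 21, 99, 3, 25, 0x1701f86b166d07a8c6219454⟩,
   ⟨14, 2, 21, 37, 5, 19, 0x8fc26f1f1df8e9bca0667ce8⟩,
   ⟨15, 2, 3, 3, 10, 99, 0xb12718b810b33⟩],
  [⟨4, 2, 22, 99, 99, 24, 0xd2d657105c9c860143⟩,
   ⟨4, 8, 22, 99, 18, 0, 0xaabe1ba8e66c86575f4ebf⟩,
   ⟨4, 14, 4, 22, 5, 99, 0xbb0b0e0c37b8a2⟩,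
   ⟨6, 2, 22, 99, 99, 25, 0x2aa6feaedca17e054c29⟩,
   ⟨6, 8, 22, 99, 7, 23, 0x214e1171f7857df3d085598b⟩,
   ⟨10, 2, 22, 99, 25, 7, 0x42b5d425f0425b3a5092f6⟩,
   ⟨12, 2, 22, 99, 36, 22, 0x2130effce0ea4056b5f8dad7⟩,
   ⟨14, 2, 4, 20, 5, 99, 0x29980b32ddd38⟩,
   ⟨14, 2, 22, 1, 35, 19, 0x3fed6bcc389fcec368ea2e407⟩],
  [⟨3, 2, 23, 99, 99, 8, 0x1497bbe30e4edcd0ae6⟩,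
   ⟨3, 8, 23, 99, 31, 15, 0xecfc44f507fcce5ca10f6c⟩,
   ⟨3, 14, 5, 99, 8, 99, 0xfb9f15a609abe3⟩,
   ⟨5, 2, 23, 99, 99, 19, 0x256168d38f5a4e7c7575⟩,
   ⟨5, 8, 23, 99, 27, 8, 0x1f6ab565b806d2744deb2d5c⟩,
   ⟨5, 14, 5, 24, 5, 99, 0x279b6730a5026e2a⟩,
   ⟨8, 8, 23, 7, 13, 25, 0x1b70e42ffbbf7683d68e202673⟩,
   ⟨9, 2, 23, 99, 25, 8, 0xecff3af29dbaa1e1a4aca4⟩,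
   ⟨11, 2, 23, 99, 99, 1, 0x1a9679e7d78b1929ac45415a⟩,
   ⟨14, 2, 5, 15, 21, 99, 0x427170da7c24eb⟩,
   ⟨14, 2, 23, 37, 3, 15, 0x1369a9b1c63985a113f5ac6628⟩],
  [⟨2, 2, 24, 99, 99, 9, 0x106016a3f5cfd0047e0⟩,
   ⟨2, 8, 24, 99, 99, 17, 0xbd97f249c395632f1dfeb2⟩,
   ⟨2, 14, 6, 99, 7, 99, 0x1b52c183350aba4⟩,
   ⟨2, 14, 24, 99, 14, 38, 0x8563a70078918dfe2e10769ac7⟩,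
   ⟨4, 2, 24, 99, 99, 19, 0xddef20d1f2562fc7575⟩,
   ⟨4, 8, 24, 99, 1, 19, 0x1a30e17dde3996e9c059538b⟩,
   ⟨4, 14, 6, 1, 7, 99, 0x274ae2f5a44e6ea1⟩,
   ⟨8, 2, 24, 99, 99, 0, 0xecf9aa9f3624339e76952f⟩,
   ⟨8, 8, 24, 3, 9, 21, 0xa62332db850f6e6f43e9b0c0c7⟩,
   ⟨10, 2, 24, 99, 99, 19, 0x98c5bbad52af861ff7186c3⟩,
   ⟨14, 2, 6, 3, 21, 99, 0x3413705ea3⟩,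
   ⟨14, 2, 24, 40, 5, 19, 0x794c0d94d9c14a7c9df7e1dea4⟩],
  [⟨1, 2, 25, 99, 99, 9, 0x14cce94e5f11b6e49cc⟩,
   ⟨1, 8, 25, 99, 99, 4, 0xaac997b3fa42a1d5261f8c⟩,
   ⟨1, 14, 7, 99, 3, 99, 0xae2d62fc508c0e⟩,
   ⟨1, 14, 25, 99, 26, 7, 0x864deb38896b51ffbb33d57702⟩,
   ⟨3, 2, 25, 99, 99, 10, 0x2ed06fab49b50c166e0c⟩,
   ⟨3, 8, 7, 99, 11, 99, 0x22f9649cb89e⟩,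
   ⟨3, 8, 25, 99, 1, 19, 0x18e31a038edc727a1f6a6faf⟩,
   ⟨4, 14, 7, 25, 5, 99, 0xeda46b23e10ed724⟩,
   ⟨4, 14, 25, 3, 42, 35, 0x3b406b327d2cbd5c36324b32df0b⟩,
   ⟨7, 2, 25, 99, 99, 31, 0xbd98fc2cd20585d78b28ff⟩,
   ⟨7, 8, 25, 99, 99, 24, 0xa82cb51b5b97301063dcbabc64⟩,
   ⟨9, 2, 25, 99, 21, 2, 0x1e4383b56edd626f6186fa56⟩,
   ⟨13, 2, 25, 99, 13, 28, 0x248dfcbcac70fb136a5ff369e5⟩,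
   ⟨14, 2, 7, 15, 10, 99, 0x7e829d7312fd7b3⟩,
   ⟨14, 2, 25, 5, 0, 28, 0x37bf1f3c2fdc2b3896fefd3da83⟩],
  [⟨2, 2, 26, 99, 99, 19, 0x1da62540eef355e509ff⟩,
   ⟨2, 8, 26, 99, 99, 8, 0x19ebea0a527f2863d5004624⟩,
   ⟨2, 14, 8, 99, 20, 99, 0x1b5e9b5fd069f161⟩,
   ⟨2, 14, 26, 99, 7, 29, 0x12abeb7c66d6a690bc53f52d1b07⟩,
   ⟨4, 14, 8, 22, 1, 99, 0x594b3659581a81efa⟩,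
   ⟨4, 14, 26, 5, 0, 28, 0x321dd47677f5e379be36faae5359f⟩,
   ⟨6, 2, 26, 99, 99, 17, 0x42b4fc42e9a4c393dec978⟩,
   ⟨6, 8, 26, 99, 16, 40, 0x86ea8ebbcbded4a5ec12b12c23⟩,
   ⟨8, 2, 26, 99, 99, 3, 0xa688271f0fe55274609456⟩,
   ⟨8, 8, 26, 99, 99, 20, 0x17b97d0bb49d4147f269d80972e8⟩,
   ⟨12, 2, 26, 99, 27, 5, 0x94ac38826514ab0ed22f9c7326⟩,
   ⟨14, 2, 8, 5, 0, 99, 0x3ad13694eed4cfe5⟩,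
   ⟨14, 2, 26, 38, 33, 22, 0x12e156c988922e2fe8748bba3628⟩],
  [⟨1, 2, 27, 99, 99, 19, 0x25738d8d85e83e22cb47⟩,
   ⟨1, 8, 27, 99, 99, 10, 0x1a9da32c9c52d9cc6bbe48a4⟩,
   ⟨1, 14, 9, 99, 20, 99, 0x302031152eb346df⟩,
   ⟨1, 14, 27, 99, 28, 5, 0x1626a0b9116fca5f33478c656fc2⟩,
   ⟨4, 14, 9, 16, 21, 99, 0x21362fb5f20625e2ca⟩,
   ⟨5, 2, 27, 99, 99, 15, 0xcac2c484055b2d93dec978⟩,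
   ⟨5, 8, 27, 99, 20, 3, 0xa4cde90c49e216132f26da99a0⟩,
   ⟨7, 2, 27, 99, 99, 2, 0x1cfd46067d40f4a074609456⟩,
   ⟨7, 8, 27, 99, 1, 20, 0x1727becdac254254c80a1c4b82ba⟩,
   ⟨8, 8, 27, 3, 9, 21, 0x8c3762f2bc600a685592df14a247⟩,
   ⟨11, 2, 27, 99, 99, 1, 0xa81d2bdf5783655c36b657d45c⟩,
   ⟨13, 2, 27, 99, 99, 24, 0x6ad56b3af8fbef0652d2b30bce8⟩,
   ⟨14, 2, 9, 21, 1, 99, 0x289e81544f6⟩,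
   ⟨14, 2, 27, 9, 15, 33, 0x8aeb816187fec47e636cd699eea3⟩],
  [⟨4, 2, 28, 99, 99, 16, 0xbd7aa0a1292230cb5454fc⟩,
   ⟨4, 8, 28, 99, 99, 33, 0x8ec9cd29d9421df29b60da547f⟩,
   ⟨4, 14, 10, 1, 25, 99, 0xd1944db1f80b42ff09⟩,
   ⟨4, 14, 28, 44, 3, 15, 0x5f9cf03de7750ddd61e480b0e25170⟩,
   ⟨6, 2, 28, 99, 99, 0, 0x3db7ba81ebd1e7e63447b57⟩,
   ⟨6, 8, 28, 99, 24, 42, 0xd0c0efb0e06a7863d4ec60bf141⟩,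
   ⟨10, 2, 28, 99, 31, 8, 0xa4cc0f15206576069abbfdd68c⟩,
   ⟨12, 2, 28, 99, 21, 1, 0x128c2d3c381b9e8ddd3748dda1fc⟩,
   ⟨14, 2, 10, 22, 17, 99, 0x6a5f6290b8e31caf6⟩,
   ⟨14, 2, 28, 44, 39, 18, 0x2a02c2fa7f8512e4238683ab601a4⟩],
  [⟨3, 2, 29, 99, 99, 1, 0xbd98fca1f0f0b6e4c4243e⟩,
   ⟨3, 8, 11, 99, 15, 99, 0x171ff8dba809d88⟩,
   ⟨3, 8, 29, 99, 33, 10, 0xa8b85d46920e8984893aeaa85c⟩,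
   ⟨5, 2, 29, 99, 99, 22, 0x172485d92d0ac7eb0b0c2e85⟩,
   ⟨5, 8, 29, 99, 33, 8, 0x17b767dff235379841b92695744c⟩,
   ⟨5, 14, 11, 9, 4, 99, 0x23ec0142019996a23a31⟩,
   ⟨8, 8, 29, 5, 0, 23, 0x12bc751e7780d575150658d3093d83⟩,
   ⟨9, 2, 29, 99, 99, 32, 0xa8b4d0edf1f7219758e36d5a3f⟩,
   ⟨11, 2, 29, 99, 99, 9, 0xe80a7763c12fa58fedd8ed03acc⟩,
   ⟨14, 2, 11, 1, 24, 99, 0x30e2af09f5e45d0f31⟩,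
   ⟨14, 2, 29, 5, 0, 23, 0x11110a4faa73f21d1ad76c25bbda83⟩],
  [⟨2, 2, 30, 99, 99, 28, 0xecff1e34e7107f8e22fb47⟩,
   ⟨2, 8, 30, 99, 99, 21, 0x84a243c4d02023e2ef15a3c50c⟩,
   ⟨2, 14, 12, 99, 1, 14, 0xff7207c1afc84542c2⟩,
   ⟨4, 2, 30, 99, 99, 5, 0x1a964d805e4de6d590fffd4c⟩,
   ⟨4, 8, 12, 99, 11, 5, 0x2903a2037b06fbc4⟩,
   ⟨8, 2, 30, 99, 99, 35, 0x22eeef138654e80e30f9cdf4ef⟩,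
   ⟨8, 8, 12, 22, 17, 11, 0xff5d79a703eacfe536⟩,
   ⟨10, 2, 30, 99, 99, 29, 0x17a199efa189b2e38a59ff9bf8df⟩,
   ⟨14, 2, 12, 19, 99, 99, 0x429af21bc63c47cbf6⟩,
   ⟨14, 2, 30, 44, 3, 15, 0x565a6489ea10466e3596bd8a1b1ea4⟩],
  [⟨1, 2, 31, 99, 99, 26, 0xbd98fca3670757bf6c7d35⟩,
   ⟨1, 8, 13, 99, 99, 4, 0x1281a98b4b2d1d4⟩,
   ⟨1, 14, 13, 99, 9, 2, 0x12c4fce0c107c85b6a8⟩,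
   ⟨3, 2, 31, 99, 99, 8, 0x213ed36918a44151ae625fe0⟩,
   ⟨3, 8, 13, 99, 12, 5, 0x29966c0785b3596c⟩,
   ⟨4, 14, 13, 2, 28, 21, 0xfd6c654f85717e8088c1⟩,
   ⟨7, 2, 31, 99, 99, 16, 0xa8a118c4ead9928a3a88b07f44⟩,
   ⟨7, 8, 13, 99, 8, 1, 0xff688d5aa53ae5a952⟩,
   ⟨9, 2, 31, 99, 33, 8, 0x17b9e19402184ca4cd60e61cfb06⟩,
   ⟨13, 2, 31, 99, 26, 44, 0x56aadd583e790eda698b89821aadbb⟩,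
   ⟨14, 2, 13, 29, 24, 99, 0x562e7a2449b94a3a638⟩,
   ⟨14, 2, 31, 47, 42, 19, 0x233cb281b3ed056c4da2c46f08701a4⟩],
  [⟨2, 2, 32, 99, 99, 19, 0x2153dd93e9c9c5c4303cbfff⟩,
   ⟨2, 8, 14, 99, 99, 2, 0x41a57ccb9bb7d2c4⟩,
   ⟨2, 14, 14, 99, 12, 29, 0x23e8c5de14b20c3f4689⟩,
   ⟨4, 14, 14, 32, 27, 19, 0x4eb22b1f4089f1832d78e⟩,
   ⟨6, 2, 32, 99, 99, 35, 0x4c8cb09b12fdf9fcae41cdf4ef⟩,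
   ⟨6, 8, 14, 99, 99, 13, 0x105fa9a871a806acf00⟩,
   ⟨8, 2, 32, 99, 99, 38, 0x71dd3e3ab9e7ec6548e19728abb⟩,
   ⟨8, 8, 14, 3, 29, 21, 0x1ccd4e305bcc7fb65d05⟩,
   ⟨12, 2, 32, 99, 99, 20, 0x600c721733b8c3ef949e011bceb5d8⟩,
   ⟨14, 2, 14, 30, 5, 99, 0x9625abcaa0e90a86c38⟩,
   ⟨14, 2, 32, 5, 0, 27, 0x108fce3a91892606e3fae7447e93da83⟩],
  [⟨1, 2, 33, 99, 99, 8, 0x1aa98383bbbe30a8a04d4ccc⟩,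
   ⟨1, 8, 15, 99, 99, 23, 0x40a45011eb56830b⟩,
   ⟨1, 14, 15, 99, 4, 24, 0x22ec3e68807ddc332051⟩,
   ⟨4, 14, 15, 17, 11, 3, 0x1e4e93c3e2b9a25e245968⟩,
   ⟨5, 2, 15, 99, 99, 6, 0x1d23b1e7bec1b74⟩,
   ⟨5, 8, 15, 99, 99, 3, 0xd25855cab10ed39428⟩,
   ⟨7, 2, 15, 99, 99, 8, 0x299c9544b0872aa4⟩,
   ⟨7, 8, 15, 99, 12, 24, 0x2a3b38e0db9b73ef2613⟩,
   ⟨11, 2, 15, 99, 10, 1, 0x146687062410f8abf0a⟩,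
   ⟨13, 2, 15, 99, 6, 18, 0x2807789beeb07646f92e⟩,
   ⟨14, 2, 15, 31, 26, 17, 0xc1e892cd1decf8462a58⟩],
  [⟨4, 2, 16, 99, 99, 22, 0x1d219188c699a27⟩,
   ⟨4, 8, 16, 99, 99, 10, 0x1075deecf63f269c002⟩,
   ⟨4, 14, 16, 3, 33, 27, 0xde574a8a16e6fc51b4d17f⟩,
   ⟨6, 2, 16, 99, 99, 3, 0x3373006a11c7dfc4⟩,
   ⟨6, 8, 16, 99, 19, 10, 0x29f6b84ce8d9191743ea⟩,
   ⟨10, 2, 16, 99, 4, 22, 0x105fab5f51584f4e9a3⟩,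
   ⟨12, 2, 16, 99, 15, 27, 0x293f43b067660f947747⟩,
   ⟨14, 2, 16, 32, 5, 17, 0x4bb9a4b8cb198c9b6dc78⟩],
  [⟨3, 2, 17, 99, 99, 5, 0x1d23b27dc323874⟩,
   ⟨3, 8, 17, 99, 12, 1, 0x137d5d6fe1f966e3e1c⟩,
   ⟨5, 2, 17, 99, 99, 3, 0x299d5353ca5e5d1c⟩,
   ⟨5, 8, 17, 99, 15, 4, 0x2bda29e9e8faed7dc5dc⟩,
   ⟨9, 2, 17, 99, 11, 24, 0xe5d6fc6180776c0493⟩,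
   ⟨11, 2, 17, 99, 12, 1, 0x2c0f0cf8a23ed28f1f12⟩,
   ⟨14, 2, 17, 33, 28, 17, 0x1b44b4bfa6e14734aadc38⟩]]

/-- The certificates with `b ≡ 3` modulo `6`, listed by the residue of `c` modulo `18`. -/
def certificates_three : List (List Certificate) := [
  [⟨1, 3, 18, 99, 99, 8, 0x175fbaeedeb234c⟩,
   ⟨1, 9, 18, 99, 99, 23, 0x102d3f4f9486d1719ef⟩,
   ⟨1, 15, 18, 99, 24, 7, 0xddef49b83a65f9759f68a4⟩,
   ⟨3, 3, 18, 99, 99, 22, 0x41c03c67f40116cb⟩,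
   ⟨3, 9, 18, 99, 8, 25, 0x23eeaedb658d30c16be1⟩,
   ⟨7, 3, 18, 99, 99, 25, 0x11caa5d99aeeb5b758f⟩,
   ⟨7, 9, 18, 8, 14, 26, 0xde5743f1af8f65cbf52469⟩,
   ⟨9, 3, 18, 99, 99, 11, 0x24d7197a1aaad2c548ce⟩,
   ⟨13, 3, 18, 34, 5, 17, 0xa42a039989a2d4c5809c78⟩],
  [⟨2, 3, 19, 99, 99, 12, 0x41c1dc0b042183b2⟩,
   ⟨2, 9, 19, 99, 8, 26, 0x2463d5cdccbda3f85347⟩,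
   ⟨2, 15, 1, 99, 0, 99, 0x360c88df49da⟩,
   ⟨4, 15, 1, 8, 1, 99, 0x525a15010f3b5⟩,
   ⟨6, 3, 19, 99, 99, 6, 0x11caa63af59de7a72c4⟩,
   ⟨6, 9, 19, 99, 12, 29, 0xa3fb33ac289eee4e740ae1⟩,
   ⟨8, 3, 19, 99, 99, 4, 0x295a17d3c45016308ce4⟩,
   ⟨8, 9, 1, 13, 0, 99, 0x37854fba200c⟩,
   ⟨8, 9, 19, 34, 3, 19, 0x19dd6e3bafe2daea59965272⟩,
   ⟨12, 3, 19, 99, 6, 28, 0xafeb47551decd43764d2a3⟩,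
   ⟨14, 3, 1, 2, 99, 99, 0x19f31ffe3⟩,
   ⟨14, 3, 19, 1, 31, 18, 0x1c69853e93d044c8d11838a8⟩],
  [⟨1, 3, 20, 99, 99, 22, 0x349a903e2abc4c1f⟩,
   ⟨1, 9, 20, 99, 99, 4, 0x2aa14c0d76ab713c661c⟩,
   ⟨1, 15, 2, 99, 2, 99, 0x555d567ee666⟩,
   ⟨1, 15, 20, 99, 34, 21, 0xf5ec1150357f3b3eb670a8b⟩,
   ⟨4, 15, 2, 5, 11, 99, 0x4608b6234ea649⟩,
   ⟨5, 3, 20, 99, 99, 14, 0x1090eb34d9da213da5c⟩,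
   ⟨5, 9, 20, 99, 5, 26, 0xb7f1939b47ac95d1e132d7⟩,
   ⟨7, 3, 20, 99, 99, 26, 0x2ec9eeceab60160ee2f3⟩,
   ⟨7, 9, 20, 3, 35, 21, 0x1f44745ddbfe3949a0004685⟩,
   ⟨11, 3, 20, 99, 34, 15, 0xca0acff0746ae613bc1aac⟩,
   ⟨13, 3, 2, 18, 5, 99, 0x20128e34f348⟩,
   ⟨13, 3, 20, 10, 16, 28, 0x1d5d4c80a00f8776b13561f1⟩],
  [⟨4, 3, 21, 99, 99, 9, 0xd1dbcc24d8bf5d0ae6⟩,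
   ⟨4, 9, 21, 99, 18, 1, 0xec9acf58de131280ad4fac⟩,
   ⟨4, 15, 3, 3, 19, 99, 0xc12de66790c301⟩,
   ⟨4, 15, 21, 28, 23, 11, 0x4d42d530802071e1dbceefad92⟩,
   ⟨6, 3, 21, 99, 99, 25, 0x2155567df571753cbbc7⟩,
   ⟨6, 9, 21, 99, 99, 17, 0x9dff758fd7ee19255fb94b4⟩,
   ⟨10, 3, 21, 99, 28, 6, 0xd12c91a8d5c5c7eba4dfd6⟩,
   ⟨12, 3, 21, 99, 3, 25, 0x17f5bd1ddf4059e07c219454⟩,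
   ⟨13, 3, 21, 32, 27, 12, 0x9f1f4d4118400b903de2ddee⟩,
   ⟨14, 3, 3, 1, 18, 99, 0x24500e09391⟩],
  [⟨3, 3, 22, 99, 99, 20, 0x106016a381e011458bf⟩,
   ⟨3, 9, 22, 99, 22, 5, 0xec5b5d3ea18115ee649040⟩,
   ⟨3, 15, 4, 99, 7, 99, 0x1325c819d8f0919⟩,
   ⟨5, 3, 22, 99, 99, 27, 0x2e56607a98f1d836f567⟩,
   ⟨5, 9, 22, 99, 31, 16, 0x14fbdf0518614553b1b4030c⟩,
   ⟨5, 15, 4, 22, 3, 99, 0x1a0f1e728cdefca2⟩,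
   ⟨9, 3, 22, 99, 32, 15, 0x95faf8a1508c85b8b6baac⟩,
   ⟨11, 3, 22, 99, 20, 9, 0x1aa5db3da778830edde10680⟩,
   ⟨13, 3, 4, 10, 16, 99, 0x2991eb29228c0⟩,
   ⟨13, 3, 22, 38, 5, 17, 0x33c46ef2b2c743bff8ed5cca4⟩],
  [⟨2, 3, 23, 99, 99, 22, 0x10a5202000d74a6bbaf⟩,
   ⟨2, 9, 23, 99, 23, 6, 0xd7cfe0068fdedd9a799aa4⟩,
   ⟨2, 15, 5, 99, 1, 99, 0xfba27dc9c505b5⟩,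
   ⟨4, 3, 23, 99, 99, 8, 0x2804e0d2bf3bf9dd5cdc⟩,
   ⟨4, 9, 23, 99, 36, 21, 0x14fbedeabf930916ab068fdc⟩,
   ⟨4, 15, 5, 11, 4, 99, 0x324dc0153985ba0d⟩,
   ⟨7, 9, 23, 1, 36, 19, 0x1b7158bf9f1e5929b69219313b⟩,
   ⟨8, 3, 23, 99, 25, 4, 0xcac39c679b189cf4ce86a0⟩,
   ⟨10, 3, 23, 99, 99, 28, 0x1701fe2a33236594c93a8223⟩,
   ⟨13, 3, 5, 1, 18, 99, 0x21bc16b430f83⟩,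
   ⟨13, 3, 23, 0, 5, 17, 0x167c53337a022006a5d28a01a4⟩],
  [⟨1, 3, 24, 99, 99, 2, 0x10a4eddd18f9a046ccc⟩,
   ⟨1, 9, 24, 99, 99, 15, 0xbd95f0f49534567630fe92⟩,
   ⟨1, 15, 6, 99, 13, 99, 0x1cb2e08fc2c0668⟩,
   ⟨1, 15, 24, 99, 16, 38, 0x70366c118d7d6a063c1c917269⟩,
   ⟨3, 3, 24, 99, 99, 14, 0xddef20d1f256403ba0c⟩,
   ⟨3, 9, 6, 99, 6, 99, 0x5c1e34e5d5b3⟩,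
   ⟨3, 9, 24, 99, 2, 20, 0x1a89e988faba3acd656fbf1b⟩,
   ⟨5, 15, 24, 37, 32, 13, 0x15e5fbd24d7d6d96c1be0066ff678⟩,
   ⟨7, 3, 24, 99, 99, 25, 0xbd967dd3f873eaf75cd3b5⟩,
   ⟨7, 9, 6, 5, 0, 99, 0xde793f49f74163⟩,
   ⟨7, 9, 24, 99, 99, 22, 0x9e4e7cf04bf97ab280e0b2b7b0⟩,
   ⟨9, 3, 24, 99, 27, 8, 0x1d6d1fcc2a406d42bee5ca76⟩,
   ⟨13, 3, 6, 17, 12, 99, 0x1502d7e66525b42⟩,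
   ⟨13, 3, 24, 10, 16, 29, 0xa56e3c6c3cccc8dd03e46a790f⟩],
  [⟨2, 3, 25, 99, 99, 10, 0x2ec9f7d6f8f68b022c9c⟩,
   ⟨2, 9, 7, 99, 8, 99, 0x5656fd6c93d2⟩,
   ⟨2, 9, 25, 99, 8, 26, 0x1aa3d84942c03007594dbf21⟩,
   ⟨4, 15, 7, 1, 23, 99, 0x58732d83ce24d4709⟩,
   ⟨4, 15, 25, 17, 23, 44, 0x3494c67df3ea95ffff24ffa4e5b81⟩,
   ⟨6, 3, 25, 99, 99, 11, 0xbd98d8997bd4676af6fd72⟩,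
   ⟨6, 9, 25, 99, 99, 6, 0x4e963914c8b7471dc727e87590⟩,
   ⟨7, 9, 25, 12, 18, 30, 0x3e5140c7a9ea59a0eb888984dcd⟩,
   ⟨8, 3, 25, 99, 99, 15, 0x398569eeeb89c1d011b3b24⟩,
   ⟨12, 3, 25, 99, 99, 20, 0x83950c4a1713cf1334eec9d800⟩,
   ⟨13, 3, 7, 22, 3, 99, 0x2320bcd7a22def6⟩,
   ⟨13, 3, 25, 40, 3, 15, 0x31cab2a332939cf81d859706628⟩],
  [⟨1, 3, 26, 99, 99, 24, 0x2ed070d4ab941a32cb47⟩,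
   ⟨1, 9, 26, 99, 99, 1, 0x20fcf8093b96f5fe38e4df6c⟩,
   ⟨1, 15, 8, 99, 24, 99, 0x1df43e721dcd55c9⟩,
   ⟨1, 15, 26, 99, 28, 6, 0xb1248f32ed9f767a92b924f9fc2⟩,
   ⟨4, 15, 8, 4, 9, 99, 0x21362fb5f20625e289⟩,
   ⟨5, 3, 26, 99, 99, 12, 0x96191741327ed6aed3efec⟩,
   ⟨5, 9, 26, 99, 37, 17, 0x6acb2d23c3391921a4d7a77c30⟩,
   ⟨7, 3, 26, 99, 99, 8, 0xa688271f0fe5529ef64560⟩,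
   ⟨7, 9, 26, 38, 1, 13, 0x106aa907ae7e95d8e0dc06ffebf0⟩,
   ⟨11, 3, 26, 99, 99, 14, 0x94f959bb9f66ce4661ca4fcb64⟩,
   ⟨13, 3, 8, 15, 10, 99, 0x2d6563197ad1450f⟩,
   ⟨13, 3, 26, 1, 39, 19, 0x143a840b38e3b7cea8c9eac1b207⟩],
  [⟨4, 3, 27, 99, 99, 15, 0xb0cbfdb9da94461b904be6⟩,
   ⟨4, 9, 27, 99, 99, 30, 0xa84e024899a08cc4923048d881⟩,
   ⟨4, 15, 9, 14, 9, 99, 0xf8aa874a862fc90028⟩,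
   ⟨4, 15, 27, 46, 41, 17, 0x5f152fec8476a6d9879b0f13977074⟩,
   ⟨6, 3, 27, 99, 99, 25, 0x3db7ba78df31b41cf07f4dc⟩,
   ⟨6, 9, 27, 99, 29, 9, 0x17b7645aebc6c4948170a9e7d46c⟩,
   ⟨7, 9, 27, 5, 0, 23, 0x8e4c9c27e0a4fcad41342bbfac83⟩,
   ⟨10, 3, 27, 99, 99, 31, 0x94f959bb9f66ce4661d9b1b555⟩,
   ⟨12, 3, 27, 99, 99, 33, 0x17439b7cfd27dc0ef7a12d4edf7b⟩,
   ⟨13, 3, 9, 22, 17, 99, 0x11066d23a6bc4e818⟩,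
   ⟨13, 3, 27, 39, 1, 22, 0x714336a661bf060a812732b27628⟩],
  [⟨3, 3, 28, 99, 99, 1, 0xab29f59ce85bef4f3cbfb2⟩,
   ⟨3, 9, 10, 99, 9, 99, 0x133300210373567⟩,
   ⟨3, 9, 28, 99, 15, 39, 0x82ae595bab4e473c6e06b86635⟩,
   ⟨5, 3, 28, 99, 99, 25, 0x215163b45445e375ea08bdaf⟩,
   ⟨5, 9, 28, 99, 2, 19, 0x1743bfde2caffa570cedabc6bb8b⟩,
   ⟨5, 15, 10, 21, 16, 99, 0x23ec0142019996a239f3⟩,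
   ⟨8, 9, 28, 41, 1, 19, 0xf7d69ac284d0590c86237a1ec0582⟩,
   ⟨9, 3, 28, 99, 99, 19, 0xa8b8afb6712fb41a80bed6d4b7⟩,
   ⟨11, 3, 28, 99, 99, 22, 0x17b6b17daa329273bbb09301eb5f⟩,
   ⟨13, 3, 10, 1, 23, 99, 0x1da867b6e52f4e783⟩,
   ⟨13, 3, 28, 35, 30, 8, 0x29c33260d53ed7038acc4cd8fb764⟩],
  [⟨2, 3, 29, 99, 99, 1, 0xecff147216ccf94f3cbfb2⟩,
   ⟨2, 9, 11, 99, 21, 99, 0x2adc89e78dead0⟩,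
   ⟨2, 9, 29, 99, 1, 19, 0x86f4e9de3178e5a9d77bb9738b⟩,
   ⟨4, 3, 29, 99, 99, 31, 0x147f9c1097175338596affff⟩,
   ⟨4, 9, 29, 99, 33, 8, 0x1646c2ed2283002b3a692695744c⟩,
   ⟨4, 15, 11, 1, 7, 99, 0x2a3b38e1ed21f0867fdf⟩,
   ⟨7, 9, 29, 41, 1, 13, 0xfa98740f9210afd1579a3badbebf0⟩,
   ⟨8, 3, 29, 99, 99, 18, 0x329b37562bee5c138c6eeddaf4⟩,
   ⟨10, 3, 29, 99, 99, 3, 0x17b6b17daa4d915350e3adca4898⟩,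
   ⟨13, 3, 11, 16, 11, 99, 0x27e35e34511dbed467⟩,
   ⟨13, 3, 29, 5, 0, 23, 0x14022390159db01d3fe248eb2f5a83⟩],
  [⟨1, 3, 30, 99, 99, 20, 0xab18f2ab86116115c0b47f⟩,
   ⟨1, 9, 30, 99, 99, 21, 0xa700c750cf05745b6f15a3c50c⟩,
   ⟨1, 15, 12, 99, 23, 17, 0xd183bea642da514352⟩,
   ⟨3, 3, 30, 99, 99, 27, 0x1f377b041519703bae625fff⟩,
   ⟨3, 9, 12, 99, 18, 12, 0x409f92d077c6de58⟩,
   ⟨7, 3, 30, 99, 99, 24, 0xa86ec0af80395755b9be97c6cc⟩,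
   ⟨7, 9, 12, 17, 12, 6, 0xff5d968491e334fe8c⟩,
   ⟨9, 3, 30, 99, 99, 20, 0x17b9e17c729932a591c9af05813f⟩,
   ⟨13, 3, 12, 19, 99, 99, 0x1259026da4566f1d836⟩,
   ⟨13, 3, 30, 35, 30, 6, 0x5df73159dfcd63c7f84bb35d2d58b8⟩],
  [⟨2, 3, 31, 99, 99, 7, 0x2153e468283307d6f480a74c⟩,
   ⟨2, 9, 13, 99, 12, 5, 0x4114e1f8e34292c4⟩,
   ⟨6, 3, 31, 99, 99, 24, 0xa638cc84092149f3c1be97c6cc⟩,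
   ⟨6, 9, 13, 99, 19, 13, 0x125c224bfdac3d1161a⟩,
   ⟨7, 9, 13, 27, 3, 15, 0x59c0c3e6c0a01758842⟩,
   ⟨8, 3, 31, 99, 99, 3, 0x12f8ee38662d313cc4796e515784⟩,
   ⟨12, 3, 31, 99, 9, 37, 0x5e862b41dd4bfb371ec88c1f82789f⟩,
   ⟨13, 3, 13, 5, 0, 99, 0x562e817cdcbd28d09e5⟩,
   ⟨13, 3, 31, 5, 0, 23, 0x2d07c57f57cd0fec746095f9b2f5a83⟩],
  [⟨1, 3, 32, 99, 99, 25, 0x21517a761966ab7a38fa3daf⟩,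
   ⟨1, 9, 14, 99, 99, 12, 0x409f92d14de7a440⟩,
   ⟨1, 15, 14, 99, 12, 29, 0x2a3faa7eef72fa3f4689⟩,
   ⟨4, 15, 14, 30, 1, 18, 0x1d864105318d1481a32e42⟩,
   ⟨5, 3, 14, 99, 99, 7, 0x16ffde66cb0c3c4⟩,
   ⟨5, 9, 14, 99, 99, 6, 0x1075db90e43c14830c8⟩,
   ⟨7, 3, 14, 99, 99, 22, 0x409b3745d4502907⟩,
   ⟨7, 9, 14, 25, 20, 12, 0x2064310a6b425be9d452⟩,
   ⟨11, 3, 14, 99, 16, 28, 0x125501a3bfef63afae3⟩,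
   ⟨13, 3, 14, 12, 18, 30, 0x293f43b06765ec9e151d⟩],
  [⟨4, 3, 15, 99, 99, 9, 0x1d343704575c588⟩,
   ⟨4, 9, 15, 99, 99, 10, 0xe65ba4c75eca8476e8⟩,
   ⟨4, 15, 15, 1, 31, 19, 0xde56e49f709f86c813a069⟩,
   ⟨6, 3, 15, 99, 99, 1, 0x402c8e8e661dc70a⟩,
   ⟨6, 9, 15, 99, 8, 1, 0x254f12680e86e91a0cae⟩,
   ⟨10, 3, 15, 99, 19, 10, 0x11c83d621e14b210ef6⟩,
   ⟨12, 3, 15, 99, 8, 20, 0x20516dcd67034ea980ab⟩,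
   ⟨13, 3, 15, 6, 12, 24, 0xf77c44ff7996db545fe5⟩],
  [⟨3, 3, 16, 99, 99, 21, 0x1d1a13787a32017⟩,
   ⟨3, 9, 16, 99, 28, 15, 0xd1dbc9c94ae8bbe902⟩,
   ⟨5, 3, 16, 99, 99, 24, 0x40a408ab5346366f⟩,
   ⟨5, 9, 16, 99, 99, 26, 0xdd86c101592d3d78e03⟩,
   ⟨5, 15, 16, 10, 16, 29, 0x1f44cdbad7ebebbe150f3521⟩,
   ⟨9, 3, 16, 99, 1, 15, 0x105fafa4ba8c38df920⟩,
   ⟨11, 3, 16, 99, 24, 5, 0x293f43b06cdf5c423494⟩,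
   ⟨13, 3, 16, 27, 22, 12, 0x4bb9b35faaf50c7668438⟩],
  [⟨2, 3, 17, 99, 99, 9, 0x12827d1f7775a48⟩,
   ⟨2, 9, 17, 99, 12, 1, 0x1478117d6534ee875bc⟩,
   ⟨4, 3, 17, 99, 99, 3, 0x407a5c61f829624c⟩,
   ⟨4, 9, 17, 99, 2, 20, 0x256d8e51c6cb02385e91⟩,
   ⟨8, 3, 17, 99, 19, 8, 0x11caa5d99aeeb5890ee⟩,
   ⟨10, 3, 17, 99, 17, 5, 0x205173ba7e20ad08daa4⟩,
   ⟨13, 3, 17, 31, 3, 15, 0x1c660cbbdbc729ddb819d6⟩]]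

/-- The certificates with `b ≡ 4` modulo `6`, listed by the residue of `c` modulo `18`. -/
def certificates_four : List (List Certificate) := [
  [⟨2, 4, 18, 99, 99, 21, 0x299d5fc71fd7024b⟩,
   ⟨2, 10, 18, 99, 29, 16, 0x2bf35632b82f263be5a2⟩,
   ⟨6, 4, 18, 99, 99, 26, 0x11c52ad3314ae235543⟩,
   ⟨6, 10, 18, 32, 3, 18, 0xaabe191ab2ffdab082b6d4⟩,
   ⟨8, 4, 18, 99, 99, 23, 0x1d8c40ec99cd8cbc23a5⟩,
   ⟨12, 4, 18, 30, 25, 14, 0xa39edf2d7d2aba72abfbbc⟩],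
  [⟨1, 4, 19, 99, 99, 23, 0x3483e8ac0d0babff⟩,
   ⟨1, 10, 19, 99, 29, 16, 0x2aa14c0d77384a6b2cf2⟩,
   ⟨1, 16, 1, 99, 2, 99, 0x1ff55148e666⟩,
   ⟨4, 16, 1, 5, 21, 99, 0x2022e8f957a649⟩,
   ⟨5, 4, 19, 99, 99, 23, 0xf897fa6763bf2ca067⟩,
   ⟨5, 10, 19, 99, 0, 18, 0x95fac49296856674fc7444⟩,
   ⟨7, 4, 19, 99, 28, 15, 0x2805cebf100885c1eefc⟩,
   ⟨11, 4, 19, 99, 17, 3, 0xd0d2d6f77f1fd7bcf33bec⟩,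
   ⟨13, 4, 1, 17, 3, 99, 0x4cf939d6678c⟩,
   ⟨13, 4, 19, 34, 3, 15, 0x1701f86b8c8c07b600162956⟩],
  [⟨4, 4, 20, 99, 99, 4, 0xf898d4695f6fc95e10⟩,
   ⟨4, 10, 20, 99, 20, 6, 0xec671019ad58fd456c54a0⟩,
   ⟨4, 16, 2, 1, 16, 99, 0x1178b9bb056a4e1⟩,
   ⟨4, 16, 20, 1, 37, 26, 0x997d001f189a187090b67fdf0b⟩,
   ⟨6, 4, 20, 99, 99, 3, 0x24d82ef208d26d6612c4⟩,
   ⟨6, 10, 20, 8, 99, 26, 0x1e4a4bd92d84ecb2624ed1a9⟩,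
   ⟨10, 4, 20, 99, 4, 26, 0xbd7855a0ace3b0b0e640f5⟩,
   ⟨12, 4, 2, 14, 10, 99, 0x485c18b3cd40⟩,
   ⟨12, 4, 20, 3, 35, 21, 0x1c7d77eeda07abd629e2aea3⟩],
  [⟨3, 4, 21, 99, 99, 7, 0x14ce2a0ba8bb6f4cecc⟩,
   ⟨3, 10, 21, 99, 18, 1, 0xec9338a53a68684ec200bc⟩,
   ⟨3, 16, 3, 99, 10, 99, 0xa0b2c33f2c059b⟩,
   ⟨5, 4, 21, 99, 99, 13, 0x2bd9fc8e86c1fe091da2⟩,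
   ⟨5, 10, 21, 99, 17, 35, 0x17fc22633a624216b22f4cff⟩,
   ⟨5, 16, 3, 12, 18, 99, 0x2757e2c8a7194de5⟩,
   ⟨9, 4, 21, 99, 4, 26, 0xb0cac2d8e6383776aac283⟩,
   ⟨11, 4, 21, 99, 23, 10, 0x1a386189a3ffc7a53b27418a⟩,
   ⟨12, 4, 21, 5, 0, 23, 0xc326e1440248edb1dfffe7a3⟩,
   ⟨13, 4, 3, 20, 5, 99, 0x33f518bcef178⟩],
  [⟨2, 4, 22, 99, 99, 22, 0x125fc5093941e1af3af⟩,
   ⟨2, 10, 22, 99, 20, 9, 0xd76b126677cbb37f95f4a4⟩,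
   ⟨2, 16, 4, 99, 1, 99, 0x1325c819d8f45b5⟩,
   ⟨4, 4, 22, 99, 99, 1, 0x2ecb823248cc9b3c5aca⟩,
   ⟨4, 10, 22, 99, 32, 19, 0x215173c5c7818a522dbf154f⟩,
   ⟨4, 16, 4, 3, 24, 99, 0x274ae2f853e5f4e1⟩,
   ⟨8, 4, 22, 99, 13, 1, 0xbd98fb38d7ee0e0b25eed0⟩,
   ⟨10, 4, 22, 99, 23, 9, 0x14a83c9a17040ba4d4a7418a⟩,
   ⟨12, 4, 4, 5, 11, 99, 0xb720f1d77d333⟩,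
   ⟨12, 4, 22, 5, 11, 23, 0x49d69daf69db6e014a21c3d85⟩],
  [⟨1, 4, 23, 99, 99, 2, 0x1495810205a977b1a4c⟩,
   ⟨1, 10, 23, 99, 16, 34, 0xbd3f31cc645e531ecf1f47⟩,
   ⟨1, 16, 5, 99, 9, 99, 0xff3ecae1e859e1⟩,
   ⟨3, 4, 23, 99, 99, 1, 0x2804e0d2bf3bfd77aacc⟩,
   ⟨3, 10, 5, 99, 12, 99, 0x2dc8e349f156⟩,
   ⟨3, 10, 23, 99, 2, 20, 0x1a89ea041c8474324cead473⟩,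
   ⟨6, 10, 5, 9, 15, 99, 0x2d96bc72387390⟩,
   ⟨7, 4, 23, 99, 32, 15, 0xddfaf8b37160fc5aa9d98c⟩,
   ⟨9, 4, 23, 99, 21, 5, 0x1d6caa211a763e0d92bf86c6⟩,
   ⟨12, 4, 5, 1, 7, 99, 0x4546ee4a647d73⟩,
   ⟨12, 4, 23, 1, 36, 19, 0x1b92a958f106f5b5ee1d45d12b⟩],
  [⟨2, 4, 24, 99, 99, 5, 0x25708e60eb0eb3eaba20⟩,
   ⟨2, 10, 6, 99, 16, 99, 0x2a73d4c9c521⟩,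
   ⟨2, 10, 24, 99, 0, 22, 0x21317dd831a01c117368c3b0⟩,
   ⟨6, 4, 24, 99, 99, 25, 0xbd895bbd9b603c1cb683b5⟩,
   ⟨6, 10, 6, 10, 5, 99, 0x165b71cfdf489fb⟩,
   ⟨6, 10, 24, 39, 3, 15, 0x82f0929292d245f85786272930⟩,
   ⟨8, 4, 24, 99, 27, 8, 0x1c69929ae26de02df2e5ca76⟩,
   ⟨12, 4, 6, 22, 17, 99, 0x16efa336160ea38⟩,
   ⟨12, 4, 24, 36, 1, 13, 0x83ff411cd40319c90055663b2c⟩],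
  [⟨1, 4, 25, 99, 99, 24, 0x2570c72cb092189a8bff⟩,
   ⟨1, 10, 7, 99, 2, 99, 0x47a61530c742⟩,
   ⟨1, 10, 25, 99, 14, 0, 0x1a9cb4304d2aa582baf62e5f⟩,
   ⟨4, 16, 7, 23, 18, 99, 0x1991ebf21d1502fce6⟩,
   ⟨5, 4, 25, 99, 99, 8, 0xbd895bbd9b603c1cb683cc⟩,
   ⟨5, 10, 25, 99, 2, 20, 0x4c7a542ef9ba198b80f8edb043⟩,
   ⟨6, 10, 25, 1, 38, 19, 0x398ec49401ccfa4691b2b1a95c3⟩,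
   ⟨7, 4, 25, 99, 99, 17, 0x1aa9572ca802951b20f35f66⟩,
   ⟨11, 4, 25, 99, 99, 27, 0x86bb2372c14224adc7cbbd4c83⟩,
   ⟨12, 4, 7, 19, 14, 99, 0x7e120baa7b705ae⟩,
   ⟨12, 4, 25, 41, 36, 17, 0x3258e76ed52c565e8b248c20ea4⟩],
  [⟨4, 4, 26, 99, 99, 19, 0xecee1180ac441eb16f9fc7⟩,
   ⟨4, 10, 26, 99, 26, 13, 0x99b54a2836a6a8e068b568eeb4⟩,
   ⟨4, 16, 8, 14, 7, 99, 0x99692f2914323dba38⟩,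
   ⟨6, 4, 26, 99, 99, 31, 0x1a964d4bb5db041bcee8d7ff⟩,
   ⟨6, 10, 26, 15, 21, 33, 0x175e9540b38d5de52589c84ab569⟩,
   ⟨10, 4, 26, 99, 99, 14, 0x901dbef744b193dfd3ce306864⟩,
   ⟨12, 4, 8, 24, 19, 99, 0x2f46c42964012c96⟩,
   ⟨12, 4, 26, 30, 25, 8, 0x12abe4e11ca1f72e3e8a8a872d9c⟩],
  [⟨3, 4, 27, 99, 99, 34, 0xb94506ebc3d0541e72b473⟩,
   ⟨3, 10, 9, 99, 17, 99, 0x16b7d22d1b7ba1e⟩,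
   ⟨3, 10, 27, 99, 16, 34, 0x796c906a69aca6178578010b91⟩,
   ⟨5, 4, 27, 99, 99, 20, 0x10a95c662651eee08e714b3b⟩,
   ⟨5, 10, 27, 99, 39, 25, 0x1664730773cc353aa231b960440a⟩,
   ⟨5, 16, 9, 25, 20, 99, 0x23eab3c549f91f8a91d5⟩,
   ⟨6, 10, 27, 43, 5, 17, 0x6f5f5f15a1a7d65b41c9cc03b02c⟩,
   ⟨9, 4, 27, 99, 99, 14, 0x86f5125a92028f4d80ce306864⟩,
   ⟨11, 4, 27, 99, 99, 19, 0x7479c4ca9911b03d2921426f0b⟩,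
   ⟨12, 4, 9, 25, 5, 99, 0x110606a2e416304d8⟩,
   ⟨12, 4, 27, 43, 38, 17, 0x71482d5da029042ec6f918992ea4⟩],
  [⟨2, 4, 28, 99, 99, 11, 0xecff3af9d3a1683d23dd78⟩,
   ⟨2, 10, 10, 99, 16, 99, 0x1a9fa4b275156d4⟩,
   ⟨2, 10, 28, 99, 7, 28, 0x86f5615ceda46570e7f40eebc7⟩,
   ⟨4, 4, 28, 99, 99, 23, 0x214568b8f21554ebe11c1585⟩,
   ⟨4, 10, 28, 99, 1, 19, 0x12c2d1b8a5ec4afa2b6dabc6bb8b⟩,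
   ⟨4, 16, 10, 5, 30, 99, 0x2a3c4a9852235101fe61⟩,
   ⟨6, 10, 28, 5, 0, 23, 0x2f14c9b989473cfc92871c897c8cb⟩,
   ⟨8, 4, 28, 99, 99, 1, 0x74de090e6fdc7e3871ef43220c⟩,
   ⟨10, 4, 28, 99, 99, 1, 0x14f2b9ec9725f9214130169e23be⟩,
   ⟨12, 4, 10, 26, 5, 99, 0x6f06302797fabe238⟩,
   ⟨12, 4, 28, 5, 11, 23, 0x349109bd208c1216f1be25a3b6283⟩],
  [⟨1, 4, 29, 99, 99, 20, 0xeca19aea5a6489b4a0347f⟩,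
   ⟨1, 10, 11, 99, 21, 99, 0xb115865fddead0⟩,
   ⟨1, 10, 29, 99, 7, 25, 0x7e89b9d6c3d17bd44f73499347⟩,
   ⟨3, 4, 29, 99, 99, 36, 0x20fceea6f936a0c7915f707f⟩,
   ⟨3, 10, 11, 99, 19, 99, 0x28eb5ab6681bcf0a⟩,
   ⟨3, 10, 29, 99, 29, 3, 0x1646c49ff4398121c7aeefd7a66c⟩,
   ⟨6, 10, 11, 23, 1, 99, 0x1ae62bebd86e378ba8⟩,
   ⟨6, 10, 29, 41, 1, 13, 0xfa96b22586fe914219b48805febf0⟩,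
   ⟨7, 4, 29, 99, 18, 36, 0x865a151fa7bc9b032597c81ad7⟩,
   ⟨9, 4, 29, 99, 99, 6, 0x17b9ac6f062ca18cd616687a297c⟩,
   ⟨12, 4, 11, 13, 8, 99, 0x27e365dc018ea52793⟩,
   ⟨12, 4, 29, 5, 0, 25, 0x11a37833ad9fe79a467b4734bcbd83⟩],
  [⟨2, 4, 30, 99, 99, 24, 0x2153dd9dac9a09565b1d977f⟩,
   ⟨2, 10, 12, 99, 17, 11, 0x299670424566a690⟩,
   ⟨6, 4, 30, 99, 99, 22, 0x9e5e0704b022d25c2fb8bb3cff⟩,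
   ⟨6, 10, 12, 18, 13, 7, 0xf8b7d74c9c89ad3808⟩,
   ⟨8, 4, 30, 99, 99, 23, 0x1743dbdf3eed32dbcba9c648f2af⟩,
   ⟨12, 4, 12, 17, 23, 99, 0x125501a55c210abbdef⟩,
   ⟨12, 4, 30, 42, 37, 13, 0x5df7339ed2db12e93e94fad04a3628⟩],
  [⟨1, 4, 31, 99, 99, 14, 0x2153e468287154c196da954c⟩,
   ⟨1, 10, 13, 99, 12, 5, 0x299670431b5ef96c⟩,
   ⟨5, 4, 13, 99, 99, 7, 0x1d17cbcc9eb23c4⟩,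
   ⟨5, 10, 13, 99, 9, 2, 0xd25a26f9e6f36bfa34⟩,
   ⟨7, 4, 13, 99, 2, 20, 0x2f71354538807f03⟩,
   ⟨11, 4, 13, 99, 15, 8, 0xccd06590d1e7bbbef6⟩,
   ⟨12, 4, 13, 1, 26, 19, 0x6f529808b63b566daa3⟩],
  [⟨4, 4, 14, 99, 99, 19, 0x8c3c73073bab47⟩,
   ⟨4, 10, 14, 99, 11, 3, 0x12592dec84eccdc2d64⟩,
   ⟨6, 4, 14, 99, 99, 1, 0x3319e719e909cd52⟩,
   ⟨6, 10, 14, 99, 24, 6, 0x27e9ace2b959fa0342ca⟩,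
   ⟨10, 4, 14, 99, 10, 22, 0x105fa9a86f2b6579ea3⟩,
   ⟨12, 4, 14, 1, 27, 19, 0x27e8da0fe2d6a19754d5⟩],
  [⟨3, 4, 15, 99, 99, 9, 0x1d1a1366c410720⟩,
   ⟨3, 10, 15, 99, 9, 1, 0xd1612ac3b3bb9855c8⟩,
   ⟨5, 4, 15, 99, 99, 12, 0x409f940811c85576⟩,
   ⟨5, 10, 15, 99, 20, 11, 0x22f9da470934acea29a0⟩,
   ⟨9, 4, 15, 99, 10, 1, 0x11bcd430307d8662f12⟩,
   ⟨11, 4, 15, 99, 22, 3, 0x27e8da36dc1eab588d54⟩,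
   ⟨12, 4, 15, 31, 26, 17, 0xd1bc74b8cda3080a2a58⟩],
  [⟨2, 4, 16, 99, 99, 22, 0x1281d290dd4626f⟩,
   ⟨2, 10, 16, 99, 21, 13, 0xf8da04ac02ca9855e2⟩,
   ⟨4, 4, 16, 99, 99, 19, 0x407aac505af37b47⟩,
   ⟨4, 10, 16, 99, 20, 11, 0x2e550dfeb905ea609fa0⟩,
   ⟨8, 4, 16, 99, 9, 24, 0x128e2cd54bb4085e893⟩,
   ⟨10, 4, 16, 99, 17, 29, 0x21a861973f8f956da6cf⟩,
   ⟨12, 4, 16, 3, 31, 21, 0x59cd16d783bdf491d86e5⟩],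
  [⟨1, 4, 17, 99, 99, 20, 0x1745bca694dfe5f⟩,
   ⟨1, 10, 17, 99, 27, 16, 0x13794bd482e9a774cf2⟩,
   ⟨3, 4, 17, 99, 99, 4, 0x299f892413b6ea6c⟩,
   ⟨3, 10, 17, 99, 17, 5, 0x2c2216399abeb583739c⟩,
   ⟨6, 10, 17, 5, 0, 23, 0x24ff5dfa83e6b76349f521⟩,
   ⟨7, 4, 17, 99, 99, 8, 0x147f746b000fd9b8cee⟩,
   ⟨9, 4, 17, 99, 99, 6, 0x1d8c3faa4d9656d84fce⟩,
   ⟨12, 4, 17, 31, 3, 15, 0x1df35072c2ef13a31a39d6⟩]]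

/-- The certificates with `b ≡ 5` modulo `6`, listed by the residue of `c` modulo `18`. -/
def certificates_five : List (List Certificate) := [
  [⟨1, 5, 18, 99, 99, 11, 0x3483b773da8546ec⟩,
   ⟨1, 11, 18, 99, 17, 4, 0x2aa55b7285136e78a854⟩,
   ⟨5, 5, 18, 99, 99, 26, 0x14959080091a846039f⟩,
   ⟨5, 11, 18, 99, 25, 16, 0xb5cc7269ffb7729c7385ee⟩,
   ⟨7, 5, 18, 99, 25, 14, 0x1d34395dd49424dcd566⟩,
   ⟨11, 5, 18, 10, 16, 28, 0xcaa540411fc9e5cf41619b⟩],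
  [⟨4, 5, 19, 99, 99, 17, 0x14cc01defc6aa2c8a24⟩,
   ⟨4, 11, 19, 99, 18, 5, 0x9389ac3fe238fb2595e31c⟩,
   ⟨4, 17, 1, 10, 1, 99, 0xbac1a53dfe880d⟩,
   ⟨6, 5, 19, 99, 22, 12, 0x2ec9ed7b6c233f17f3b6⟩,
   ⟨10, 5, 19, 99, 33, 21, 0x92f4a1699e2233e2726b3f⟩,
   ⟨12, 5, 1, 18, 13, 99, 0x42bf291ead00⟩,
   ⟨12, 5, 19, 3, 9, 21, 0x1c69856e502ff902a5324673⟩],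
  [⟨3, 5, 20, 99, 99, 16, 0x10915d8531276441b82⟩,
   ⟨3, 11, 20, 99, 10, 28, 0xb1bf5848b2c904e2e58b69⟩,
   ⟨3, 17, 2, 99, 10, 99, 0xb15ee8639f9666⟩,
   ⟨5, 5, 20, 99, 99, 30, 0x249b9d65214689456c9f⟩,
   ⟨5, 11, 2, 5, 0, 99, 0x31d12f918325⟩,
   ⟨5, 11, 20, 99, 15, 35, 0x18dc878d3aaa2d0e9f4838ff⟩,
   ⟨9, 5, 20, 99, 19, 4, 0xca98ab44ee778bd5953836⟩,
   ⟨11, 5, 2, 16, 3, 99, 0x127b083ae34e⟩,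
   ⟨11, 5, 20, 32, 1, 13, 0x17025627b65dab628788c956⟩],
  [⟨2, 5, 21, 99, 99, 9, 0x14982ae79863ca743ac⟩,
   ⟨2, 11, 21, 99, 24, 7, 0xecfa3a9462a639b14f1960⟩,
   ⟨2, 17, 3, 99, 21, 99, 0x1189269c57d1889⟩,
   ⟨4, 5, 21, 99, 99, 3, 0x2550662b9810b7a2a99c⟩,
   ⟨4, 11, 21, 99, 0, 21, 0x1f44765e71ad01e8f1c1c870⟩,
   ⟨4, 17, 3, 3, 23, 99, 0x2757e4f585f94b39⟩,
   ⟨8, 5, 21, 99, 11, 29, 0xa8c018dfcb8eff5ed47be5⟩,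
   ⟨10, 5, 21, 99, 19, 7, 0x2153dcb9fb14bfe0c59a4bf6⟩,
   ⟨11, 5, 21, 26, 21, 9, 0x9d61544819ba2660b4ccc962⟩,
   ⟨12, 5, 3, 1, 7, 99, 0x6efb7464a9ba3⟩],
  [⟨1, 5, 22, 99, 99, 21, 0x10a45443df24926c8bf⟩,
   ⟨1, 11, 22, 99, 21, 5, 0xecfc57fe8de58276203e62⟩,
   ⟨1, 17, 4, 99, 5, 99, 0xa3b6b527040668⟩,
   ⟨3, 5, 22, 99, 99, 2, 0xddeb87befdc1c0baacc⟩,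
   ⟨3, 11, 4, 99, 5, 99, 0x31eeeb8485d8⟩,
   ⟨3, 11, 22, 99, 1, 20, 0x18fcb985d20e63cb4cead473⟩,
   ⟨5, 11, 4, 4, 10, 99, 0xcc57ebec80ca9⟩,
   ⟨7, 5, 22, 99, 20, 8, 0xbd98fb38d7ee1790c83ff6⟩,
   ⟨9, 5, 22, 99, 33, 12, 0x1d63af42485ee55726d23e4c⟩,
   ⟨11, 5, 4, 1, 18, 99, 0x2a8948d610355⟩,
   ⟨11, 5, 22, 1, 35, 21, 0x42204a3938b58d47bcc16c407⟩],
  [⟨2, 5, 23, 99, 99, 29, 0x25708e212fdeed044aff⟩,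
   ⟨2, 11, 5, 99, 7, 99, 0x1ff580f07b24⟩,
   ⟨2, 11, 23, 99, 10, 32, 0x1a9d90fc934da2cede8ce9ab⟩,
   ⟨5, 11, 5, 12, 18, 99, 0x4608b70db1d606⟩,
   ⟨5, 11, 23, 39, 5, 22, 0x15d2d5027761cd59bd359c12f0⟩,
   ⟨6, 5, 23, 99, 99, 2, 0xbd3f2890f0a93aae8db2a8⟩,
   ⟨8, 5, 23, 99, 18, 5, 0x21455150c1c8cd0e2c39d624⟩,
   ⟨11, 5, 5, 14, 10, 99, 0x3aa4eb25802ff3⟩,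
   ⟨11, 5, 23, 1, 36, 19, 0x1c19deb831d2019194c3093307⟩],
  [⟨1, 5, 24, 99, 99, 29, 0x1d946a9ea004d88e4aff⟩,
   ⟨1, 11, 6, 99, 16, 99, 0x42eb62e7ad21⟩,
   ⟨1, 11, 24, 99, 3, 25, 0x1a9d90fc934da2cfde2029bf⟩,
   ⟨5, 5, 24, 99, 99, 20, 0xd0d5b943158c159006f047⟩,
   ⟨5, 11, 6, 3, 21, 99, 0xfc280b4bad8ca9⟩,
   ⟨5, 11, 24, 99, 2, 26, 0x7817a4fc190d0dd7d93a4c8993⟩,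
   ⟨7, 5, 24, 99, 25, 6, 0x1d6e465ac4e0595fad96c1d6⟩,
   ⟨11, 5, 6, 9, 14, 99, 0x19c018e4e87e7b4⟩,
   ⟨11, 5, 24, 35, 30, 12, 0x83fd7a368ccb0ff1a0bb78c364⟩],
  [⟨4, 5, 25, 99, 99, 31, 0xecee116a3cf7b2c3858def⟩,
   ⟨4, 11, 25, 99, 24, 7, 0xa6f0dea78c259152a2be0ed742⟩,
   ⟨4, 17, 7, 28, 21, 99, 0x996b878c9be4c09352⟩,
   ⟨5, 11, 25, 36, 31, 12, 0x325d0387e35cb2cb9e3a7e7ce1c⟩,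
   ⟨6, 5, 25, 99, 17, 35, 0x1716710c37e4c4ff31cabafb⟩,
   ⟨10, 5, 25, 99, 99, 14, 0x752aea5546ff05c54808e2a1a4⟩,
   ⟨11, 5, 7, 12, 18, 99, 0x9a812f7d8a999d0⟩,
   ⟨11, 5, 25, 37, 1, 16, 0x2f32a1749835b63edccd934b628⟩],
  [⟨3, 5, 26, 99, 99, 20, 0xab2a1c6628bdb1b031fa4c⟩,
   ⟨3, 11, 8, 99, 7, 99, 0xb51b8f2355608c⟩,
   ⟨3, 11, 26, 99, 29, 12, 0x9e4e6d6b994ceceecbcc5ea0a8⟩,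
   ⟨5, 5, 26, 99, 99, 8, 0x1aa8a2d16ef94a90c388f76c⟩,
   ⟨5, 11, 8, 2, 21, 99, 0x1f96ea7a588c2081⟩,
   ⟨5, 11, 26, 35, 30, 10, 0x12e2e6e0f1f6747161f60e89f7e4⟩,
   ⟨9, 5, 26, 99, 99, 1, 0x6acbfa5adc0b0048405ab73284⟩,
   ⟨11, 5, 8, 9, 99, 99, 0x10fb87bda8731257⟩,
   ⟨11, 5, 26, 37, 32, 12, 0x12abe52b0e748393c34add934888⟩],
  [⟨2, 5, 27, 99, 99, 1, 0xbd73887fe531d919b2b78c⟩,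
   ⟨2, 11, 9, 99, 20, 99, 0x1cc037f724a6d62⟩,
   ⟨2, 11, 27, 99, 37, 24, 0x6d91b4e309a4980a539a7e5830⟩,
   ⟨4, 5, 27, 99, 99, 11, 0x214568b8f21067074038c434⟩,
   ⟨4, 11, 27, 99, 42, 25, 0x1590f142f4dc9ed2b1c9c5e6abc8⟩,
   ⟨4, 17, 9, 28, 3, 99, 0x1c41d175f4f470653fbe⟩,
   ⟨5, 11, 27, 8, 14, 26, 0x8c3762f2c0628b39190d311935af⟩,
   ⟨8, 5, 27, 99, 99, 33, 0x83fda636f9fa4bae98426b4217⟩,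
   ⟨10, 5, 27, 99, 99, 31, 0x1781b8d33520129ae6db8e13b233⟩,
   ⟨11, 5, 9, 3, 24, 99, 0x1381625bea27c0b83⟩,
   ⟨11, 5, 27, 41, 3, 24, 0x70075f0252e6dffa704678bd2f28⟩],
  [⟨1, 5, 28, 99, 99, 3, 0xcac39c2f037a9c082aafb4⟩,
   ⟨1, 11, 10, 99, 0, 99, 0xb110334742c010⟩,
   ⟨1, 11, 28, 99, 9, 27, 0x86f561508cda795aa3c747ceef⟩,
   ⟨3, 5, 28, 99, 99, 14, 0x14fbeea0bfbbc3be900c82b6⟩,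
   ⟨3, 11, 10, 99, 5, 99, 0x3d4647df6bfe77c6⟩,
   ⟨3, 11, 28, 99, 8, 30, 0x12fb23ce25de91a3a660d6b734ef⟩,
   ⟨5, 11, 10, 3, 26, 99, 0x3d2a376a0d489bfd1⟩,
   ⟨6, 11, 28, 45, 40, 23, 0xfee2678047f1aab541231a0965170⟩,
   ⟨7, 5, 28, 99, 35, 23, 0xa8a13aad0c5bea186ae907d35c⟩,
   ⟨9, 5, 28, 99, 99, 6, 0x53b16a6fe5899a65fa22d7a297c⟩,
   ⟨11, 5, 10, 15, 20, 99, 0x8a76b16effc60ff7f⟩,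
   ⟨11, 5, 28, 33, 28, 6, 0x2a03f625cdb93c888568f01adbc78⟩],
  [⟨2, 5, 29, 99, 99, 2, 0x2153e44aa9ce0a7aa7c3b8cc⟩,
   ⟨2, 11, 11, 99, 1, 99, 0x41bcef47a9b01189⟩,
   ⟨2, 11, 29, 99, 29, 3, 0x17b76f7536fe9cf4048da07ed4ac⟩,
   ⟨5, 11, 11, 14, 20, 99, 0x340701358656c7e48f⟩,
   ⟨5, 11, 29, 41, 1, 19, 0x10035d588456cf31b8e94f697a23f0⟩,
   ⟨6, 5, 29, 99, 99, 31, 0x86ad827bb9d9d8dda33df303bf⟩,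
   ⟨8, 5, 29, 99, 99, 16, 0x1748f23eb274a38bc696c3b0918c⟩,
   ⟨11, 5, 11, 20, 15, 99, 0x280783c42edf150e76⟩,
   ⟨11, 5, 29, 12, 18, 30, 0x13891e31b77b19c51867aa6a9a36e3⟩],
  [⟨1, 5, 30, 99, 99, 2, 0x1a878014ea34385e5783b8cc⟩,
   ⟨1, 11, 12, 99, 17, 11, 0x3ded62da14ee00c8⟩,
   ⟨5, 5, 30, 99, 99, 1, 0xa8b85cdeba6a785d63a941a3fc⟩,
   ⟨5, 11, 12, 1, 25, 19, 0xd288c410e4fa8f053f⟩,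
   ⟨7, 5, 30, 99, 99, 35, 0x1748f23eb39513651589f2b1a7af⟩,
   ⟨11, 5, 12, 28, 5, 99, 0x143a76b8adfd4cde364⟩,
   ⟨11, 5, 30, 12, 18, 30, 0x76e1c8b2bab2351cce312c4b0ac423⟩],
  [⟨4, 5, 13, 99, 99, 10, 0x1d2358302d37d90⟩,
   ⟨4, 11, 13, 99, 23, 17, 0x125c2720145de0830a2⟩,
   ⟨6, 5, 13, 99, 8, 1, 0x29966c07859b800a⟩,
   ⟨10, 5, 13, 99, 20, 13, 0xccd06590d2125d4438⟩,
   ⟨11, 5, 13, 6, 12, 24, 0x6f529808b63e0085fe5⟩],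
  [⟨3, 5, 14, 99, 99, 0, 0x1cc07f0f0dba017⟩,
   ⟨3, 11, 14, 99, 17, 3, 0x1495807b01cf0c24090⟩,
   ⟨5, 5, 14, 99, 99, 10, 0x3319e719380cc090⟩,
   ⟨5, 11, 14, 21, 16, 8, 0x23e9376fd611f3953d6e⟩,
   ⟨9, 5, 14, 99, 3, 16, 0x102c5bd962f852a6716⟩,
   ⟨11, 5, 14, 12, 18, 30, 0x2bcf8e241ed731ac151d⟩],
  [⟨2, 5, 15, 99, 99, 1, 0x1cb2ee1feab394c⟩,
   ⟨2, 11, 15, 99, 28, 19, 0xd25a0f1f7b518c60fb⟩,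
   ⟨4, 5, 15, 99, 99, 12, 0x40928ebeaaf653b2⟩,
   ⟨4, 11, 15, 99, 13, 4, 0x2805dcbbe08a13e26724⟩,
   ⟨8, 5, 15, 99, 12, 3, 0x12f39ffba47bfb6a76c⟩,
   ⟨10, 5, 15, 99, 29, 22, 0x29f6ecd7a33d5d47593b⟩,
   ⟨11, 5, 15, 5, 0, 23, 0xf77ba0c807f593dcdc53⟩],
  [⟨1, 5, 16, 99, 99, 7, 0x17390c441ad3624⟩,
   ⟨1, 11, 16, 99, 15, 5, 0x14979bcfcf7e0f1406c⟩,
   ⟨3, 5, 16, 99, 99, 8, 0x33568a175677e7b0⟩,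
   ⟨3, 11, 16, 99, 22, 10, 0x2aa2d36d2260eff32012⟩,
   ⟨7, 5, 16, 99, 17, 7, 0x139526ada85a7aee3d8⟩,
   ⟨9, 5, 16, 99, 25, 16, 0x21a7ddf7eff8e99062fc⟩,
   ⟨11, 5, 16, 3, 31, 21, 0x40d388d8ef90a865d86e5⟩],
  [⟨2, 5, 17, 99, 99, 0, 0x3324673adeff096f⟩,
   ⟨2, 11, 17, 99, 20, 8, 0x2bda29ea33d5638b19a8⟩,
   ⟨5, 11, 17, 22, 17, 7, 0x1d8650fd2a316ea810576e⟩,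
   ⟨6, 5, 17, 99, 99, 26, 0xe72d4a530fdedfb01f⟩,
   ⟨8, 5, 17, 99, 14, 1, 0x293f899d67e2b591b11c⟩,
   ⟨11, 5, 17, 31, 3, 15, 0x1e976310b087f3a94639d6⟩]]

/-! ### The listed paths suffice -/

/-- All certificates, listed by the residue of `b` modulo `6` and the residue of `c` modulo `18`. -/
def certificates : List (List (List Certificate)) :=
  [certificates_zero, certificates_one, certificates_two, certificates_three, certificates_four,
    certificates_five]

/-- Growability by `1`, as claimed by a certificate. -/
def grows₁ (t : Certificate) : Bool := Nat.blt t.n₁ (t.a + t.b + t.c + 1)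

/-- Growability by `6`, as claimed by a certificate. -/
def grows₆ (t : Certificate) : Bool := Nat.blt t.n₆ (t.a + t.b + t.c + 1)

/-- Growability by `18`, as claimed by a certificate. -/
def grows₁₈ (t : Certificate) : Bool := Nat.blt t.n₁₈ (t.a + t.b + t.c + 1)

/-- The test that the lengths `1 ^ a, 6 ^ b, 18 ^ c` can be reached by growth from a certificate.
For `a = 18`, `b > 34` and `c > 36` the certificate has to be growable by `1`, `6` and `18`,
respectively, because then `a`, `b` and `c` stand for larger numbers, too. -/
def covers (t : Certificate) (a b c : ℕ) : Bool :=
  (Nat.beq t.a a && Nat.blt a 18 || Nat.ble t.a a && t.grows₁) &&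
  (Nat.beq t.b b && Nat.ble b 34 || Nat.ble t.b b && Nat.beq ((b - t.b) % 6) 0 && t.grows₆) &&
  (Nat.beq t.c c && Nat.ble c 36 || Nat.ble t.c c && Nat.beq ((c - t.c) % 18) 0 && t.grows₁₈)

/-- The test that some certificate covers the lengths `1 ^ a, 6 ^ b, 18 ^ c` if `a + b + c + 1` is
coprime to `6` and at least `37`, or if `a = 18`. -/
def isCovered (a b c : ℕ) : Bool :=
  Nat.blt a 18 && (Nat.blt (a + b + c) 36 || !Nat.beq (Nat.gcd (a + b + c + 1) 6) 1) ||
    ((certificates.getD (b % 6) []).getD (c % 18) []).any fun t => t.covers a b c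

/-- The interval `1, …, n` as a list. -/
def oneTo (n : ℕ) : List ℕ := (List.range n).map (· + 1)

theorem mem_oneTo {n x : ℕ} : x ∈ oneTo n ↔ 1 ≤ x ∧ x ≤ n := by
  simp only [oneTo, List.mem_map, List.mem_range]
  exact ⟨by rintro ⟨y, hy, rfl⟩; omega, fun h => ⟨x - 1, by omega, by omega⟩⟩

set_option maxRecDepth 100000 in
theorem check_certificates :
    certificates.all (fun r => r.all fun l => l.all check) = true := by decide +kernel

-- The bounds `40 = 34 + 6` and `54 = 36 + 18` leave room for one period of the growth by `6` and
-- `18` above the numbers that stand for themselves.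
set_option maxRecDepth 100000 in
theorem isCovered_of_le :
    (oneTo 18).all (fun a => (oneTo 40).all fun b => (oneTo 54).all fun c => isCovered a b c) =
      true := by decide +kernel

theorem check_of_mem {β γ : ℕ} {t : Certificate}
    (h : t ∈ (certificates.getD β []).getD γ []) : t.check := by
  have key := check_certificates
  simp only [List.all_eq_true] at key
  have mem_getD {α : Type} (l : List (List α)) (i : ℕ) (x : α) (hx : x ∈ l.getD i []) :
      ∃ r ∈ l, x ∈ r := by
    by_cases hi : i < l.length
    · exact ⟨l[i], List.getElem_mem hi, by rwa [List.getD_eq_getElem _ _ hi] at hx⟩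
    · rw [List.getD_eq_default _ _ (by omega)] at hx
      simp at hx
  obtain ⟨l, hl, ht⟩ := mem_getD _ _ _ h
  obtain ⟨r, hr, hl⟩ := mem_getD _ _ _ hl
  exact key r hr l hl t ht

/-- The representative of `b` among `1, …, n + m` modulo `m`; the numbers up to `n` are kept. -/
def cap (n m b : ℕ) : ℕ := if b ≤ n then b else n + 1 + (b - n - 1) % m

/-- A certificate that covers the representatives of `a`, `b`, `c` grows to `a`, `b`, `c`. -/
theorem attains_of_covers {t : Certificate} (ht : t.check) {a b c : ℕ}
    (h : t.covers (min a 18) (cap 34 6 b) (cap 36 18 c)) : Attains a b c false false false := by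
  obtain ⟨hv, hA⟩ := attains_of_check ht
  simp only [covers, Bool.and_eq_true, Bool.or_eq_true, Nat.beq_eq, Nat.ble_eq,
    Nat.blt_eq] at h
  obtain ⟨⟨h₁, h₆⟩, h₁₈⟩ := h
  have e₁ : t.a ≤ a ∧ (t.grows₁ = true ∨ a - t.a = 0) := by
    rcases h₁ with h | h
    · exact ⟨by omega, .inr (by omega)⟩
    · exact ⟨by omega, .inl h.2⟩
  have e₆ : t.b + 6 * ((b - t.b) / 6) = b ∧ (t.grows₆ = true ∨ (b - t.b) / 6 = 0) := by
    unfold cap at h₆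
    rcases h₆ with h | h
    · split_ifs at h <;> exact ⟨by omega, .inr (by omega)⟩
    · split_ifs at h <;> exact ⟨by omega, .inl h.2⟩
  have e₁₈ : t.c + 18 * ((c - t.c) / 18) = c ∧ (t.grows₁₈ = true ∨ (c - t.c) / 18 = 0) := by
    unfold cap at h₁₈
    rcases h₁₈ with h | h
    · split_ifs at h <;> exact ⟨by omega, .inr (by omega)⟩
    · split_ifs at h <;> exact ⟨by omega, .inl h.2⟩
  have := hA.add hv e₁.2 e₆.2 e₁₈.2
  rwa [Nat.add_sub_cancel' e₁.1, e₆.1, e₁₈.1] at this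

theorem attains {a b c : ℕ} (ha : 1 ≤ a) (hb : 1 ≤ b) (hc : 1 ≤ c) (hv : 36 ≤ a + b + c)
    (hg : Nat.gcd (a + b + c + 1) 6 = 1) : Attains a b c false false false := by
  have key := isCovered_of_le
  simp only [List.all_eq_true, mem_oneTo] at key
  have := key (min a 18) (by omega) (cap 34 6 b) (by unfold cap; split_ifs <;> omega)
    (cap 36 18 c) (by unfold cap; split_ifs <;> omega)
  rw [isCovered, Bool.or_eq_true] at this
  rcases this with h | h
  · exfalso
    simp only [Bool.and_eq_true, Bool.or_eq_true, Nat.blt_eq, Bool.not_eq_true',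
      ← Bool.not_eq_true, Nat.beq_eq] at h
    obtain ⟨ha', h | h⟩ := h
    -- If `b` or `c` has been replaced, the new sum is at least `36`, as `1 + 35 + 1 ≥ 36` and
    -- `1 + 1 + 37 ≥ 36`; otherwise the sum is the old one.
    · unfold cap at h
      split_ifs at h <;> omega
    · refine h ?_
      have hb' : cap 34 6 b ≡ b [MOD 6] := by
        unfold cap Nat.ModEq; split_ifs <;> omega
      have hc' : cap 36 18 c ≡ c [MOD 6] := by
        unfold cap Nat.ModEq; split_ifs <;> omega
      rw [min_eq_left (by omega)]
      exact ((((hb'.add_left a).add hc').add_right 1).gcd_eq).trans hg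
  · rw [List.any_eq_true] at h
    obtain ⟨t, ht, h⟩ := h
    exact attains_of_covers (check_of_mem ht) h

end Certificate

/-! ### The multisets with support `{1, 6, 18}` -/

theorem eq_lengths {L : Multiset ℕ} (hL : ∀ x ∈ L, x = 1 ∨ x = 6 ∨ x = 18) :
    L = lengths (L.count 1) (L.count 6) (L.count 18) := by
  ext x
  simp only [lengths, Multiset.count_add, Multiset.count_replicate]
  by_cases hx : x ∈ L
  · rcases hL x hx with rfl | rfl | rfl <;> simp
  · rw [Multiset.count_eq_zero_of_notMem hx]
    split_ifs <;> simp_all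

theorem mainTheorem8 (v : ℕ) (hv : v ≠ 47 ∧ v ≠ 49 ∧ v ≠ 59) :
    CoprimeBHRHolds v {1, 6, 18} := by
  intro L hS hL
  have hmem (x : ℕ) : x ∈ L ↔ x = 1 ∨ x = 6 ∨ x = 18 := by
    rw [← Multiset.mem_toFinset, hS]; simp
  have e := eq_lengths fun x => (hmem x).1
  have ha : 1 ≤ L.count 1 := Multiset.one_le_count_iff_mem.2 ((hmem 1).2 (by simp))
  have hb : 1 ≤ L.count 6 := Multiset.one_le_count_iff_mem.2 ((hmem 6).2 (by simp))
  have hc : 1 ≤ L.count 18 := Multiset.one_le_count_iff_mem.2 ((hmem 18).2 (by simp))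
  have hg : Nat.gcd v 6 = 1 := hL.coprime 6 ((hmem 6).2 (by simp))
  have h18 : 18 ≤ v / 2 := (hL.support_subset 18 ((hmem 18).2 (by simp))).2
  have hcard := hL.card_add_one
  rw [e] at hcard
  simp only [lengths, Multiset.card_add, Multiset.card_replicate] at hcard
  -- The length `18` forces `36 ≤ v`, and `36` is not coprime to `6`.
  have hv36 : v ≠ 36 := by rintro rfl; revert hg; decide
  rw [← hcard] at hg
  have := (Certificate.attains ha hb hc (by omega) hg).isRealizable (by omega)
  rwa [hcard, ← e] at this
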